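/- All graphs are finite, simple and undirected. For a graph $G$, $|G|$ is its number of vertices, $\eta(G)$ (the Hadwiger number) is the largest $n$ such that $K_n$ is a minor of $G$, and $G\square H$ is the Cartesian product. Vortices: let $K$ be an embedded graph with a facial cycle $(v_1,\dots,v_k)$. A graph $G$ containing $K$ as a subgraph is obtained from $K$ by adding a vortex at this face, of width $\max_i|S_i|$, if there are sets (bags) $S_1,\dots,S_k\subseteq V(G)$ such that $V(G)=V(K)\cup\bigcup_i S_i$; every edge of $G$ whose ends do not both lie in $\bigcup_i S_i$ is an edge of $K$; $v_i\in S_i$ and $S_i\cap V(K)\subseteq\{v_1,\dots,v_k\}$ for each $i$; for each $v\in\bigcup_iS_i$ the set $\{i:v\in S_i\}$ is of the form $[i,j]$ or $[i,k]\cup[1,j]$; and every edge of $G$ with both ends in $\bigcup_iS_i$ has both ends in some $S_i$. Theorem. Let $c\ge 1$ be an integer, and let $G$ and $H$ be connected graphs with $|G|\ge 2c^2-c+2$ and $|H|\ge 2c^2-c+2$. If $\eta(G\square H)\le c$, then $G\square H$ is (isomorphic to) one of the following graphs: (1) a graph obtained from a planar grid $P_m\square P_n$ with $m,n\ge2$ by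 adding a vortex of width at most $2(8c+9)^2$ in the outerface; (2) a graph obtained from a cylindrical grid $P_m\square C_n$ with $m\ge2$, $n\ge3$ by adding a vortex of width at most $16c+18$ in each of the two big faces (those bounded by the two end copies of $C_n$); (3) a toroidal grid $C_m\square C_n$ with $m,n\ge3$. -/

import Mathlib

namespace ProductMinor

universe u v

/-- `H` is a minor of `G`: the branch sets `X v` are connected (in particular nonempty), pairwise
disjoint, and adjacent in `G` whenever the corresponding vertices are adjacent in `H`. -/
def IsMinor {V : Type u} {W : Type v} (H : SimpleGraph V) (G : SimpleGraph W) : Prop :=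
  ∃ X : V → Set W,
    (∀ a, (G.induce (X a)).Connected) ∧
    (∀ a b, a ≠ b → Disjoint (X a) (X b)) ∧
    (∀ a b, H.Adj a b → ∃ x ∈ X a, ∃ y ∈ X b, G.Adj x y)

/-- The Hadwiger number: the largest `n` such that `K_n` is a minor of `G`
(meant for finite graphs, where the set is bounded, see `bddAbove_cliqueMinors`). -/
noncomputable def hadwigerNumber {V : Type u} (G : SimpleGraph V) : ℕ :=
  sSup {n : ℕ | IsMinor (⊤ : SimpleGraph (Fin n)) G}

theorem bddAbove_cliqueMinors {V : Type u} [Fintype V] (G : SimpleGraph V) :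
    BddAbove {n : ℕ | IsMinor (⊤ : SimpleGraph (Fin n)) G} := by
  refine ⟨Fintype.card V, ?_⟩
  rintro n ⟨X, hconn, hdisj, -⟩
  have hne : ∀ a, ∃ x, x ∈ X a := fun a => by
    obtain ⟨x⟩ := (hconn a).nonempty
    exact ⟨x.1, x.2⟩
  choose f hf using hne
  have hinj : Function.Injective f := fun a b hab => by
    by_contra hne
    exact Set.disjoint_left.mp (hdisj a b hne) (hf a) (hab ▸ hf b)
  simpa using Fintype.card_le_of_injective f hinj

/-- `F` runs once, in cyclic order, around a cycle of `K` whose vertex set is exactly `B`. -/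
structure IsCycleThrough {U : Type u} (K : SimpleGraph U) (B : Set U) {k : ℕ} (F : Fin k → U) :
    Prop where
  three_le : 3 ≤ k
  injective : Function.Injective F
  range_eq : Set.range F = B
  adj : ∀ i j, (SimpleGraph.cycleGraph k).Adj i j → K.Adj (F i) (F j)

/-- `S` is the sequence of bags of a vortex: `G` is obtained from `K` (a subgraph of `G` via the
injection `f`) by adding the bags `S 0, …, S (k-1)` at the facial cycle `F 0, …, F (k-1)`. -/
structure IsVortex {U : Type u} {W : Type v} (K : SimpleGraph U) {k : ℕ} (F : Fin k → U)
    (G : SimpleGraph W) (f : U ↪ W) (S : Fin k → Set W) : Prop where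
  map_adj : ∀ a b, K.Adj a b → G.Adj (f a) (f b)
  /-- every vertex of `G` that is not in `K` is in some bag -/
  new_vertex : ∀ x, x ∉ Set.range f → ∃ i, x ∈ S i
  /-- an edge of `G` whose ends are not both in bags is an edge of `K` -/
  old_edge : ∀ x y, G.Adj x y → ¬ ((∃ i, x ∈ S i) ∧ (∃ i, y ∈ S i)) →
    ∃ a b, K.Adj a b ∧ f a = x ∧ f b = y
  facial_mem : ∀ i, f (F i) ∈ S i
  old_mem : ∀ i a, f a ∈ S i → a ∈ Set.range F
  /-- the bags containing a given vertex are cyclically consecutive -/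
  interval : ∀ x, (∃ i, x ∈ S i) → ∃ i j,
    {l | x ∈ S l} = Set.Icc i j ∨ {l | x ∈ S l} = Set.Ici i ∪ Set.Iic j
  /-- an edge of `G` whose ends are both in bags has both ends in a common bag -/
  edge_mem : ∀ x y, G.Adj x y → (∃ i, x ∈ S i) → (∃ i, y ∈ S i) → ∃ i, x ∈ S i ∧ y ∈ S i

/-- `G` is obtained from `K` by adding a vortex of width at most `w` at the facial cycle `F`;
`f` is the resulting inclusion of the vertices of `K` in those of `G`. -/
def AddsVortex {U : Type u} {W : Type v} (K : SimpleGraph U) {k : ℕ} (F : Fin k → U) (w : ℕ)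
    (G : SimpleGraph W) (f : U ↪ W) : Prop :=
  ∃ S : Fin k → Set W, IsVortex K F G f S ∧ ∀ i, (S i).encard ≤ w

/-- The `m × n` planar grid, the product of two paths. -/
def planarGrid (m n : ℕ) : SimpleGraph (Fin m × Fin n) :=
  (SimpleGraph.pathGraph m).boxProd (SimpleGraph.pathGraph n)

/-- The cylindrical grid, the product of a path and a cycle. -/
def cylindricalGrid (m n : ℕ) : SimpleGraph (Fin m × Fin n) :=
  (SimpleGraph.pathGraph m).boxProd (SimpleGraph.cycleGraph n)

/-- The toroidal grid, the product of two cycles. -/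
def toroidalGrid (m n : ℕ) : SimpleGraph (Fin m × Fin n) :=
  (SimpleGraph.cycleGraph m).boxProd (SimpleGraph.cycleGraph n)

/-- The vertices on the outerface of the `m × n` planar grid. For `m, n ≥ 2` the grid has exactly
one cycle with this vertex set, which is the facial cycle of the outerface. -/
def outerVertices (m n : ℕ) : Set (Fin m × Fin n) :=
  {p | p.1.val = 0 ∨ p.1.val + 1 = m ∨ p.2.val = 0 ∨ p.2.val + 1 = n}

/-- The vertices on the first big face of the cylindrical grid. -/
def bottomVertices (m n : ℕ) : Set (Fin m × Fin n) := {p | p.1.val = 0}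

/-- The vertices on the second big face of the cylindrical grid. -/
def topVertices (m n : ℕ) : Set (Fin m × Fin n) := {p | p.1.val + 1 = m}

/-- `G` is a planar grid with a vortex of width at most `w` in the outerface. -/
def IsPlanarGridWithVortex {W : Type u} (G : SimpleGraph W) (w : ℕ) : Prop :=
  ∃ m n : ℕ, 2 ≤ m ∧ 2 ≤ n ∧
    ∃ (k : ℕ) (F : Fin k → Fin m × Fin n),
      IsCycleThrough (planarGrid m n) (outerVertices m n) F ∧
      ∃ f : (Fin m × Fin n) ↪ W, AddsVortex (planarGrid m n) F w G f

/-- `G` is a cylindrical grid with a vortex of width at most `w` in each of the two big faces: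
a graph `K` is obtained from the grid by adding a vortex at one of the two end cycles, and `G` is
obtained from `K` by adding a vortex at the other one. -/
def IsCylindricalGridWithVortices {W : Type u} (G : SimpleGraph W) (w : ℕ) : Prop :=
  ∃ m n : ℕ, 2 ≤ m ∧ 3 ≤ n ∧
    ∃ (k l : ℕ) (F : Fin k → Fin m × Fin n) (F' : Fin l → Fin m × Fin n),
      IsCycleThrough (cylindricalGrid m n) (bottomVertices m n) F ∧
      IsCycleThrough (cylindricalGrid m n) (topVertices m n) F' ∧
      ∃ (U : Type u) (K : SimpleGraph U) (f : (Fin m × Fin n) ↪ U) (g : U ↪ W),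
        AddsVortex (cylindricalGrid m n) F w K f ∧
        AddsVortex K (fun i => f (F' i)) w G g

/-- `G` is (isomorphic to) a toroidal grid. -/
def IsToroidalGrid {W : Type u} (G : SimpleGraph W) : Prop :=
  ∃ m n : ℕ, 3 ≤ m ∧ 3 ≤ n ∧ Nonempty (G ≃g toroidalGrid m n)

end ProductMinor

/-! Suppose that `G □ H` has no `K_{c+1}` minor. Two constructions of clique minors force each
factor to be a cycle, or a path with a small clump of vertices at each end. The structure of the
product can then be read off.

Leaves. Suppose that `p` vertices of `H` lie outside a connected set `D` and each has a neighbour in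
`D`. The copies of `G` at these vertices are joined pairwise through private copies of `D`, and two
spare copies of `D` complete a `K_{p+2}` (`isMinor_boxProd_of_leaves`). A search of `H` by maximal
paths turns the last vertex of each path into such a leaf (`LeafInv.extend`). Hence every search of
either factor uses at most `c - 2` paths.

Balance. Let `r` be a vertex of `G` with a neighbour `y` and two disjoint branches of at least `c +
1` vertices attached to `r`, both avoiding `y`. Then `c + 1` tokens can be placed in a copy of `G`
and rearranged while passing from one copy to an adjacent one: the branches serve as stacks, and the
tokens pass through `r` one at a time. A token parked at `y` is adjacent to each token passing
through `r`. The trace of a token over all copies is a branch set. All meetings together need about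
`c ^ 2 / 2` copies, and each search path of `H` wastes only linearly many. As there are few paths,
the size of `H` suffices (`HasBalance.isMinor`), so neither factor has balance.

Shape. With few leaves there is a long path (`exists_long_path`). Without balance, the vertices of
this path that are far from its ends have degree two in the whole graph. A longest path of vertices
of degree two either closes up to a cycle, which is then the whole graph, or it separates two clumps
of at most `2 * c + 2` vertices. Larger clumps, or clumps that are joined, would give balance
(`isCycle_or_exists_isBlobPath`).

Products. Collapsing the clumps retracts the product onto a grid, with nontrivial fibres only over
the boundary. Unions of fibres over consecutive boundary vertices are the bags of a vortex
(`addsVortex_of_retraction`). The widths obtained, `2 * (2 * c + 2) ^ 2` for the planar and `2 * (2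
* c + 2)` for the cylindrical grid, are below the required ones. -/

namespace ProductMinor

/-! ### Connected vertex sets -/

section Connectivity

variable {V W : Type*} {G : SimpleGraph V}

theorem connected_induce_singleton (a : V) : (G.induce {a}).Connected := by
  rw [SimpleGraph.connected_iff_exists_forall_reachable]
  refine ⟨⟨a, rfl⟩, ?_⟩
  rintro ⟨b, rfl⟩
  exact SimpleGraph.Reachable.refl _

theorem Connected.induce_congr {s s' : Set V} (h : (G.induce s).Connected) (e : s = s') :
    (G.induce s').Connected := e ▸ h

theorem connected_induce_insert {s : Set V} {a b : V} (h : (G.induce s).Connected) (ha : a ∈ s)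
    (hab : G.Adj a b) : (G.induce (insert b s)).Connected := by
  have := SimpleGraph.connected_induce_union (G := G) h.preconnected
    (connected_induce_singleton (G := G) b).preconnected ha rfl hab
  rwa [Set.union_singleton] at this

/-- This form suits branch sets made of many pieces that all hang on one connected core: each piece
is checked separately against the core. -/
theorem connected_induce_of_core {s B : Set V} (hs : (G.induce s).Connected) (hsB : s ⊆ B)
    (h : ∀ x ∈ B, ∃ u ⊆ B, x ∈ u ∧ (G.induce u).Connected ∧ (u ∩ s).Nonempty) :
    (G.induce B).Connected := by
  obtain ⟨⟨a, ha⟩⟩ := hs.nonempty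
  refine SimpleGraph.induce_connected_of_patches a (hsB ha) ?_
  intro x hx
  obtain ⟨u, huB, hxu, hu, hus⟩ := h x hx
  exact ⟨u ∪ s, Set.union_subset huB hsB, Or.inr ha, Or.inl hxu,
    (SimpleGraph.induce_union_connected hu.preconnected hs.preconnected hus).preconnected _ _⟩

/-- A walk inside `s` from `a` to `x` must leave `T` along some edge. With `T` the part already
explored, this is how all later explorations continue. -/
theorem exists_adj_of_connected_induce {s T : Set V} {a x : V} (h : (G.induce s).Connected)
    (ha : a ∈ T) (has : a ∈ s) (hx : x ∈ s) (hxT : x ∉ T) :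
    ∃ u ∈ T, ∃ v ∈ s, v ∉ T ∧ u ∈ s ∧ G.Adj u v := by
  have key : ∀ y : s, (G.induce s).Reachable ⟨a, has⟩ y → y.1 ∉ T →
      ∃ u ∈ T, ∃ v ∈ s, v ∉ T ∧ u ∈ s ∧ G.Adj u v := by
    intro y hy
    rw [SimpleGraph.reachable_iff_reflTransGen] at hy
    induction hy with
    | refl => exact fun h => absurd ha h
    | @tail b c _ hbc ih =>
      intro hc
      by_cases hb : b.1 ∈ T
      · exact ⟨b, hb, c, c.2, hc, b.2, hbc⟩
      · exact ih hb
  exact key ⟨x, hx⟩ (h.preconnected _ _) hxT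

theorem connected_induce_image {G' : SimpleGraph W} (φ : G →g G') {s : Set V}
    (h : (G.induce s).Connected) : (G'.induce (φ '' s)).Connected := by
  obtain ⟨⟨a, ha⟩⟩ := h.nonempty
  rw [SimpleGraph.connected_iff_exists_forall_reachable]
  refine ⟨⟨φ a, a, ha, rfl⟩, ?_⟩
  rintro ⟨_, x, hx, rfl⟩
  let ψ : G.induce s →g G'.induce (φ '' s) :=
    ⟨fun y => ⟨φ y.1, y.1, y.2, rfl⟩, fun {u v} huv => φ.map_adj huv⟩
  exact (h.preconnected ⟨a, ha⟩ ⟨x, hx⟩).map ψ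

theorem connected_induce_univ (h : G.Connected) : (G.induce Set.univ).Connected := by
  exact (SimpleGraph.Iso.connected_iff (SimpleGraph.induceUnivIso G)).mpr h

/-- The vertices that can be reached from `a` by walking in `s`. -/
def reachIn (G : SimpleGraph V) (s : Set V) (a : V) : Set V :=
  {x | Relation.ReflTransGen (fun u v => G.Adj u v ∧ v ∈ s) a x}

theorem self_mem_reachIn (s : Set V) (a : V) : a ∈ reachIn G s a := Relation.ReflTransGen.refl

theorem mem_reachIn_of_adj {s : Set V} {a x y : V} (hx : x ∈ reachIn G s a) (hxy : G.Adj x y)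
    (hy : y ∈ s) : y ∈ reachIn G s a := Relation.ReflTransGen.tail hx ⟨hxy, hy⟩

theorem reachIn_subset {s : Set V} {a : V} : reachIn G s a ⊆ insert a s := by
  intro x hx
  induction hx with
  | refl => exact Or.inl rfl
  | tail _ h _ => exact Or.inr h.2

theorem connected_reachIn (s : Set V) (a : V) : (G.induce (reachIn G s a)).Connected := by
  rw [SimpleGraph.connected_iff_exists_forall_reachable]
  refine ⟨⟨a, self_mem_reachIn s a⟩, ?_⟩
  rintro ⟨x, hx⟩
  induction hx with
  | refl => exact SimpleGraph.Reachable.refl _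
  | tail hb hbc ih =>
    refine ih.trans (SimpleGraph.Adj.reachable ?_)
    exact hbc.1

theorem subset_reachIn {s T : Set V} {a : V} (hT : (G.induce T).Connected) (ha : a ∈ T)
    (hTs : T ⊆ s) : T ⊆ reachIn G s a := by
  intro x hx
  by_contra hxn
  obtain ⟨u, hu, v, hv, hvn, -, huv⟩ :=
    exists_adj_of_connected_induce hT (self_mem_reachIn (G := G) s a) ha hx hxn
  exact hvn (mem_reachIn_of_adj hu huv (hTs hv))

/-- A connected set containing `r` can be built up from `r` one vertex at a time. -/
theorem exists_growth [Finite V] {r : V} {A : Set V} (hr : r ∉ A)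
    (hA : (G.induce (insert r A)).Connected) (t : ℕ) (ht : t ≤ A.ncard) :
    ∃ f : ℕ → V, Set.InjOn f (Set.Iio t) ∧ (∀ k < t, f k ∈ A) ∧
      ∀ k ≤ t, (G.induce {x | x = r ∨ ∃ j < k, x = f j}).Connected := by
  induction t with
  | zero =>
    refine ⟨fun _ => r, by simp, by simp, ?_⟩
    intro k hk
    obtain rfl : k = 0 := by omega
    exact Connected.induce_congr (connected_induce_singleton r) (by ext x; simp)
  | succ t ih =>
    obtain ⟨f, hinj, hfA, hconn⟩ := ih (by omega)
    set T : Set V := {x | x = r ∨ ∃ j < t, x = f j} with hT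
    have hcard : (f '' Set.Iio t).ncard = t := by
      rw [Set.InjOn.ncard_image hinj]; simp
    obtain ⟨x, hxA, hx⟩ : ∃ x ∈ A, x ∉ f '' Set.Iio t := by
      by_contra! h
      have := Set.ncard_le_ncard h (Set.toFinite _)
      omega
    have hxT : x ∉ T := by
      rintro (rfl | ⟨j, hj, rfl⟩)
      · exact hr hxA
      · exact hx ⟨j, hj, rfl⟩
    obtain ⟨u, huT, v, hv, hvT, -, huv⟩ := exists_adj_of_connected_induce (T := T) hA (Or.inl rfl)
      (Or.inl rfl) (Or.inr hxA) hxT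
    have hvA : v ∈ A := by
      rcases hv with rfl | hv
      · exact absurd (Or.inl rfl) hvT
      · exact hv
    have hold : ∀ j < t, Function.update f t v j = f j := fun j hj =>
      Function.update_of_ne (by omega) _ _
    refine ⟨Function.update f t v, ?_, ?_, ?_⟩
    · intro i hi j hj hij
      simp only [Set.mem_Iio] at hi hj
      rcases Nat.lt_succ_iff_lt_or_eq.mp hi with hi' | rfl <;>
        rcases Nat.lt_succ_iff_lt_or_eq.mp hj with hj' | rfl
      · rw [hold i hi', hold j hj'] at hij
        exact hinj hi' hj' hij
      · rw [hold i hi', Function.update_self] at hij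
        exact absurd (Or.inr ⟨i, hi', hij.symm⟩) hvT
      · rw [hold j hj', Function.update_self] at hij
        exact absurd (Or.inr ⟨j, hj', hij⟩) hvT
      · rfl
    · intro k hk
      rcases Nat.lt_succ_iff_lt_or_eq.mp hk with hk' | rfl
      · rw [hold k hk']; exact hfA k hk'
      · rw [Function.update_self]; exact hvA
    · intro k hk
      rcases Nat.le_succ_iff.mp hk with hk' | rfl
      · refine Connected.induce_congr (hconn k hk') ?_
        ext x
        refine or_congr_right (exists_congr fun j => and_congr_right fun hj => ?_)
        rw [hold j (by omega)]
      · have := connected_induce_insert (hconn t le_rfl) huT huv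
        refine Connected.induce_congr this ?_
        ext x
        simp only [Set.mem_ofPred_eq, Set.mem_insert_iff]
        symm
        constructor
        · rintro (rfl | ⟨j, hj, rfl⟩)
          · exact Or.inr (Or.inl rfl)
          · rcases Nat.lt_succ_iff_lt_or_eq.mp hj with hj' | rfl
            · rw [hold j hj']; exact Or.inr (Or.inr ⟨j, hj', rfl⟩)
            · rw [Function.update_self]; exact Or.inl rfl
        · rintro (rfl | rfl | ⟨j, hj, rfl⟩)
          · exact Or.inr ⟨t, by omega, by rw [Function.update_self]⟩
          · exact Or.inl rfl
          · exact Or.inr ⟨j, by omega, by rw [hold j hj]⟩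

end Connectivity

/-! ### Clique minors of products from leaves -/

section Minor

universe u₁ u₂ u₃

theorem IsMinor.of_iso {U : Type u₁} {V : Type u₂} {W : Type u₃} {K : SimpleGraph U}
    {G : SimpleGraph V} {G' : SimpleGraph W} (h : IsMinor K G) (φ : G ≃g G') : IsMinor K G' := by
  obtain ⟨X, hc, hd, ha⟩ := h
  refine ⟨fun a => φ '' X a, fun a => connected_induce_image φ.toHom (hc a), fun a b hab => ?_,
    fun a b hab => ?_⟩
  · exact (Set.disjoint_image_iff φ.injective).mpr (hd a b hab)
  · obtain ⟨x, hx, y, hy, hxy⟩ := ha a b hab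
    exact ⟨φ x, ⟨x, hx, rfl⟩, φ y, ⟨y, hy, rfl⟩, φ.map_adj_iff.mpr hxy⟩

theorem isMinor_top_of_family {ι : Type*} [Fintype ι] {V : Type u₂} {G : SimpleGraph V} {n : ℕ}
    (hn : Fintype.card ι = n) (X : ι → Set V) (hc : ∀ i, (G.induce (X i)).Connected)
    (hd : ∀ i j, i ≠ j → Disjoint (X i) (X j))
    (ha : ∀ i j, i ≠ j → ∃ x ∈ X i, ∃ y ∈ X j, G.Adj x y) :
    IsMinor (⊤ : SimpleGraph (Fin n)) G := by
  let e := (Fintype.equivFinOfCardEq hn).symm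
  exact ⟨fun a => X (e a), fun a => hc _, fun a b hab => hd _ _ (e.injective.ne hab),
    fun a b hab => ha _ _ (e.injective.ne hab)⟩

theorem le_hadwigerNumber {V : Type u₂} [Fintype V] {G : SimpleGraph V} {n : ℕ}
    (h : IsMinor (⊤ : SimpleGraph (Fin n)) G) : n ≤ hadwigerNumber G :=
  le_csSup (bddAbove_cliqueMinors G) h

/-- Supplies a private vertex of `G`, hence a private copy of `D` in the product, for every pair of
leaves. Values at sets that are not pairs are never used. -/
theorem exists_injOn_pairs {V : Type*} (p : ℕ) (T : Finset V) (hT : p.choose 2 ≤ T.card)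
    (g₀ : V) : ∃ E : Finset (Fin p) → V,
      Set.InjOn E {s | s.card = 2} ∧ ∀ s, s.card = 2 → E s ∈ T := by
  classical
  obtain ⟨e⟩ : Nonempty ((Finset.powersetCard 2 (Finset.univ : Finset (Fin p))) ↪ T) := by
    apply Function.Embedding.nonempty_of_card_le
    simpa using hT
  have hmem : ∀ s : Finset (Fin p), s.card = 2 →
      s ∈ Finset.powersetCard 2 (Finset.univ : Finset (Fin p)) := by
    intro s hs; simp [Finset.mem_powersetCard, hs]
  refine ⟨fun s => if h : s.card = 2 then (e ⟨s, hmem s h⟩ : V) else g₀, ?_, ?_⟩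
  · intro s hs s' hs' h
    simp only [Set.mem_ofPred_eq] at hs hs'
    simp only [hs, hs', dite_true] at h
    simpa using e.injective (Subtype.ext h)
  · intro s hs
    simp only [hs, dite_true]
    exact (e _).2

/-- If `p` vertices of `H` all have neighbours in a connected set `D` avoiding them, and `G` is
connected and large enough, then `K_{p+2}` is a minor of the product. -/
theorem isMinor_boxProd_of_leaves {V : Type u₂} {W : Type u₃} [Fintype V] {G : SimpleGraph V}
    {H : SimpleGraph W} (hG : G.Connected) {p : ℕ} (hp : p.choose 2 + 2 ≤ Fintype.card V)
    {D : Set W} (hD : (H.induce D).Connected) (l : Fin p → W) (hl : Function.Injective l)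
    (hlD : ∀ i, l i ∉ D) (hladj : ∀ i, ∃ d ∈ D, H.Adj d (l i)) :
    IsMinor (⊤ : SimpleGraph (Fin (p + 2))) (G.boxProd H) := by
  classical
  obtain ⟨g₀⟩ := hG.nonempty
  have : Nontrivial V := Fintype.one_lt_card_iff_nontrivial.mp (by omega)
  obtain ⟨g₁, hg⟩ := hG.preconnected.exists_adj_of_nontrivial g₀
  obtain ⟨E, hEinj, hET⟩ := exists_injOn_pairs p ((Finset.univ.erase g₀).erase g₁) (by
    rw [Finset.card_erase_of_mem (by simp [hg.ne']), Finset.card_erase_of_mem (by simp),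
      Finset.card_univ]
    omega) g₀
  have hE0 : ∀ s, s.card = 2 → E s ≠ g₀ := fun s hs h => by simpa [h] using hET s hs
  have hE1 : ∀ s, s.card = 2 → E s ≠ g₁ := fun s hs h => by simpa [h] using hET s hs
  have hslice : ∀ g : V, ((G.boxProd H).induce {x | x.1 = g ∧ x.2 ∈ D}).Connected := by
    intro g
    have := connected_induce_image (G' := G.boxProd H) (G.boxProdRight H g).toHom hD
    refine Connected.induce_congr this ?_
    ext ⟨a, b⟩
    simp [SimpleGraph.boxProdRight, eq_comm, and_comm]
  have htrack : ∀ h : W, ((G.boxProd H).induce {x | x.2 = h}).Connected := by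
    intro h
    have := connected_induce_image (G' := G.boxProd H) (G.boxProdLeft H h).toHom
      (connected_induce_univ hG)
    refine Connected.induce_congr this ?_
    ext ⟨a, b⟩
    simp [SimpleGraph.boxProdLeft, eq_comm]
  -- The copy of `D` reserved for the pair `i < j` goes to `i`. There it touches both the copy of
  -- `G` at `l i`, which keeps `B i` connected, and the copy of `G` at `l j`, which makes `B i` and
  -- `B j` adjacent.
  let B : Fin p → Set (V × W) := fun i =>
    {x | x.2 = l i ∨ (x.2 ∈ D ∧ ∃ j, i < j ∧ x.1 = E {i, j})}
  let C : Bool → Set (V × W) := fun b => {x | x.1 = (if b then g₀ else g₁) ∧ x.2 ∈ D}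
  have hpair : ∀ i j : Fin p, i < j → ({i, j} : Finset (Fin p)).card = 2 := fun i j hij =>
    Finset.card_pair hij.ne
  have hBC : ∀ i b, Disjoint (B i) (C b) := by
    intro i b
    rw [Set.disjoint_left]
    rintro ⟨x, y⟩ hx ⟨h1, h2⟩
    rcases hx with h | ⟨-, j, hij, h⟩
    · exact hlD i (by simpa [← h] using h2)
    · simp only at h h1
      rw [h] at h1
      cases b
      · exact hE1 _ (hpair i j hij) (by simpa using h1)
      · exact hE0 _ (hpair i j hij) (by simpa using h1)
  have hBB : ∀ i j, i < j → Disjoint (B i) (B j) := by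
    intro i j hij
    rw [Set.disjoint_left]
    rintro ⟨x, y⟩ hx hy
    rcases hx with h | ⟨hD1, k, hik, h⟩ <;> rcases hy with h' | ⟨hD2, k', hjk, h'⟩ <;>
      simp only at *
    · exact hij.ne (hl (h.symm.trans h'))
    · exact hlD i (h ▸ hD2)
    · exact hlD j (h' ▸ hD1)
    -- A common private copy means `{i, k} = {j, k'}` with `i < k` and `j < k'`, which is impossible
    -- for `i < j`.
    · have := hEinj (hpair i k hik) (hpair j k' hjk) (h.symm.trans h')
      have hi : i ∈ ({j, k'} : Finset (Fin p)) := this ▸ Finset.mem_insert_self _ _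
      simp only [Finset.mem_insert, Finset.mem_singleton] at hi
      rcases hi with rfl | rfl
      · exact lt_irrefl _ hij
      · exact lt_asymm hij hjk
  obtain ⟨⟨d₀, hd₀⟩⟩ := hD.nonempty
  have hCadj : ∀ i b, ∃ x ∈ B i, ∃ y ∈ C b, (G.boxProd H).Adj x y := by
    intro i b
    obtain ⟨d, hd, hadj⟩ := hladj i
    exact ⟨((if b then g₀ else g₁), l i), Or.inl rfl, ((if b then g₀ else g₁), d), ⟨rfl, hd⟩,
      Or.inr ⟨hadj.symm, rfl⟩⟩
  have hBadj : ∀ i j, i < j → ∃ x ∈ B i, ∃ y ∈ B j, (G.boxProd H).Adj x y := by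
    intro i j hij
    obtain ⟨d, hd, hadj⟩ := hladj j
    exact ⟨(E {i, j}, d), Or.inr ⟨hd, j, hij, rfl⟩, (E {i, j}, l j), Or.inl rfl,
      Or.inr ⟨hadj, rfl⟩⟩
  have hcardι : Fintype.card (Fin p ⊕ Bool) = p + 2 := by simp
  refine isMinor_top_of_family hcardι (Sum.elim B C) ?_ ?_ ?_
  · rintro (i | b)
    · refine connected_induce_of_core (htrack (l i)) (fun x hx => Or.inl hx) ?_
      rintro ⟨x, y⟩ (h | ⟨h, j, hij, hx⟩)
      · exact ⟨_, fun x hx => Or.inl hx, h, htrack (l i), ⟨(x, l i), rfl, rfl⟩⟩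
      · obtain ⟨d, hd, hadj⟩ := hladj i
        refine ⟨{z | z.1 = E {i, j} ∧ z.2 ∈ D} ∪ {z | z.2 = l i}, ?_, Or.inl ⟨hx, h⟩, ?_,
          ⟨(x, l i), Or.inr rfl, rfl⟩⟩
        · rintro z (⟨hz1, hz2⟩ | hz)
          · exact Or.inr ⟨hz2, j, hij, hz1⟩
          · exact Or.inl hz
        · exact SimpleGraph.connected_induce_union (hslice _).preconnected (htrack _).preconnected
            (v := (E {i, j}, d)) (w := (E {i, j}, l i)) ⟨rfl, hd⟩ rfl (Or.inr ⟨hadj, rfl⟩)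
    · exact hslice _
  · rintro (i | b) (j | b') hij
    · rcases lt_or_gt_of_ne (fun h => hij (congrArg _ h)) with h | h
      · exact hBB i j h
      · exact (hBB j i h).symm
    · exact hBC i b'
    · exact (hBC j b).symm
    · have hbb : b ≠ b' := fun h => hij (congrArg _ h)
      show Disjoint (C b) (C b')
      rw [Set.disjoint_left]
      rintro ⟨x, y⟩ ⟨h1, -⟩ ⟨h2, -⟩
      simp only at h1 h2
      rw [h1] at h2
      cases b <;> cases b' <;> simp_all [hg.ne, hg.ne']
  · rintro (i | b) (j | b') hij
    · rcases lt_or_gt_of_ne (fun h => hij (congrArg _ h)) with h | h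
      · exact hBadj i j h
      · obtain ⟨x, hx, y, hy, hxy⟩ := hBadj j i h
        exact ⟨y, hy, x, hx, hxy.symm⟩
    · exact hCadj i b'
    · obtain ⟨x, hx, y, hy, hxy⟩ := hCadj j b
      exact ⟨y, hy, x, hx, hxy.symm⟩
    · have hbb : b ≠ b' := fun h => hij (congrArg _ h)
      refine ⟨((if b then g₀ else g₁), d₀), ⟨rfl, hd₀⟩, ((if b' then g₀ else g₁), d₀),
        ⟨rfl, hd₀⟩, Or.inl ⟨?_, rfl⟩⟩
      cases b <;> cases b' <;> simp_all [hg.symm]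

end Minor

/-! ### Searching a graph by maximal paths -/

section Leaves

variable {V W : Type*} {H : SimpleGraph W}

theorem connected_induce_union_chain {s : Set W} {h : W} {l : List W}
    (hs : (H.induce s).Connected) (hh : h ∈ s) (hl : List.IsChain H.Adj (h :: l)) :
    (H.induce (s ∪ {x | x ∈ l})).Connected := by
  induction l generalizing s h with
  | nil => exact Connected.induce_congr hs (by simp)
  | cons a l ih =>
    rw [List.isChain_cons_cons] at hl
    refine Connected.induce_congr
      (ih (connected_induce_insert hs hh hl.1) (Set.mem_insert _ _) hl.2) ?_
    ext x
    simp only [Set.mem_union, Set.mem_insert_iff, Set.mem_ofPred_eq, List.mem_cons]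
    tauto

theorem exists_adj_last_of_isChain {h x : W} {l : List W}
    (hl : List.IsChain H.Adj (h :: (l ++ [x]))) : ∃ d ∈ h :: l, H.Adj d x := by
  rw [← List.cons_append, List.isChain_append] at hl
  refine ⟨(h :: l).getLast (by simp), List.getLast_mem _, hl.2.2 _ ?_ x (by simp)⟩
  rw [List.getLast?_eq_getLast_of_ne_nil (by simp)]
  rfl

/-- A path leaving a proper subset `S`, that cannot be prolonged outside `S`. -/
theorem exists_maximal_path [Fintype W] (hH : H.Connected) {S : Finset W} (hS : S.Nonempty)
    (hSu : ∃ x, x ∉ S) :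
    ∃ h ∈ S, ∃ (l : List W) (x : W), List.IsChain H.Adj (h :: (l ++ [x])) ∧ (l ++ [x]).Nodup ∧
      (∀ y ∈ l ++ [x], y ∉ S) ∧ ∀ y, H.Adj x y → y ∈ S ∨ y ∈ l ++ [x] := by
  classical
  obtain ⟨a, ha⟩ := hS
  obtain ⟨b, hb⟩ := hSu
  obtain ⟨u, hu, v, -, hv, -, huv⟩ := exists_adj_of_connected_induce (T := (S : Set W))
    (connected_induce_univ hH) ha trivial (x := b) trivial hb
  by_contra! hcon
  -- If every path leaving `S` at `u` could be prolonged outside `S`, there would be such paths of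
  -- every length, which is impossible in a finite graph.
  have key : ∀ n, ∃ (l : List W) (x : W), List.IsChain H.Adj (u :: (l ++ [x])) ∧
      (l ++ [x]).Nodup ∧ (∀ y ∈ l ++ [x], y ∉ S) ∧ l.length = n := by
    intro n
    induction n with
    | zero => exact ⟨[], v, by simpa using huv, by simp, by simpa using hv, rfl⟩
    | succ n ih =>
      obtain ⟨l, x, hc, hn, hd, hlen⟩ := ih
      obtain ⟨y, hxy, hyS, hyl⟩ := hcon u hu l x hc hn hd
      refine ⟨l ++ [x], y, ?_, ?_, ?_, by simp [hlen]⟩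
      · rw [← List.cons_append, List.isChain_append]
        refine ⟨hc, List.isChain_singleton _, ?_⟩
        intro p hp q hq
        rw [← List.cons_append, List.getLast?_concat] at hp
        obtain rfl : x = p := by simpa using hp
        obtain rfl : y = q := by simpa using hq
        exact hxy
      · rw [List.nodup_append]
        refine ⟨hn, by simp, ?_⟩
        rintro p hp q hq rfl
        simp only [List.mem_singleton] at hq
        exact hyl (hq ▸ hp)
      · intro z hz
        rw [List.mem_append, List.mem_singleton] at hz
        rcases hz with hz | rfl
        · exact hd z hz
        · exact hyS
  obtain ⟨l, x, -, hn, -, hlen⟩ := key (Fintype.card W)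
  have := hn.length_le_card
  simp [hlen] at this

/-- `L` is a set of leaves of the part `S` of `H` explored so far: the rest of `S` is connected and
dominates `L`, and all the neighbours of the vertices in `L` have been explored. -/
structure LeafInv (H : SimpleGraph W) (S L : Finset W) : Prop where
  sub : L ⊆ S
  conn : (H.induce ((S : Set W) \ (L : Set W))).Connected
  nbr : ∀ l ∈ L, ∃ d ∈ S, d ∉ L ∧ H.Adj d l
  closed : ∀ l ∈ L, ∀ x, H.Adj l x → x ∈ S

theorem LeafInv.singleton (a : W) : LeafInv H {a} ∅ :=
  ⟨by simp, Connected.induce_congr (connected_induce_singleton a) (by simp), by simp, by simp⟩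

theorem LeafInv.isMinor [Fintype V] {G : SimpleGraph V} (hG : G.Connected) {S L : Finset W}
    (h : LeafInv H S L) {p : ℕ} (hp : p ≤ L.card) (hV : p.choose 2 + 2 ≤ Fintype.card V) :
    IsMinor (⊤ : SimpleGraph (Fin (p + 2))) (G.boxProd H) := by
  let l : Fin p → L := fun i => L.equivFin.symm (Fin.castLE hp i)
  refine isMinor_boxProd_of_leaves hG hV h.conn (fun i => (l i : W)) ?_ ?_ ?_
  · intro i j hij
    exact Fin.castLE_injective hp (L.equivFin.symm.injective (Subtype.ext hij))
  · intro i hi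
    exact hi.2 (l i).2
  · intro i
    obtain ⟨d, hd, hdL, hadj⟩ := h.nbr _ (l i).2
    exact ⟨d, ⟨hd, hdL⟩, hadj⟩

/-- The path is maximal, so all neighbours of `x` are now explored and `x` becomes a leaf. The rest
of the path joins the connected part. Old leaves are not disturbed, because their neighbourhoods
were exhausted earlier. -/
theorem LeafInv.extend [DecidableEq W] {S L : Finset W} (hI : LeafInv H S L) {h x : W}
    {l : List W} (hh : h ∈ S) (hc : List.IsChain H.Adj (h :: (l ++ [x]))) (hn : (l ++ [x]).Nodup)
    (hd : ∀ y ∈ l ++ [x], y ∉ S) (hm : ∀ y, H.Adj x y → y ∈ S ∨ y ∈ l ++ [x]) :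
    LeafInv H (S ∪ (l ++ [x]).toFinset) (insert x L) := by
  have hxS : x ∉ S := hd x (by simp)
  have hxl : x ∉ l := by
    rw [List.nodup_append] at hn
    exact fun hx => hn.2.2 x hx x (by simp) rfl
  -- The successor of `h` on the path lies outside `S`, whereas all neighbours of a leaf lie in `S`.
  have hhL : h ∉ L := by
    intro hhL
    cases l with
    | nil => exact hxS (hI.closed h hhL x (by simpa using hc))
    | cons a l =>
      rw [List.cons_append, List.isChain_cons_cons] at hc
      exact hd a (by simp) (hI.closed h hhL a hc.1)
  have hdl : ∀ y ∈ l, y ∉ S := fun y hy => hd y (by simp [hy])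
  have hcl : List.IsChain H.Adj (h :: l) := by
    rw [← List.cons_append] at hc
    exact hc.left_of_append
  refine ⟨?_, ?_, ?_, ?_⟩
  · intro y hy
    rcases Finset.mem_insert.mp hy with rfl | hy
    · simp
    · exact Finset.mem_union_left _ (hI.sub hy)
  · refine Connected.induce_congr (connected_induce_union_chain hI.conn ⟨hh, hhL⟩ hcl) ?_
    ext y
    simp only [Set.mem_union, Set.mem_sdiff, Finset.mem_coe, Set.mem_ofPred_eq, Finset.coe_union,
      Finset.coe_insert, List.mem_toFinset, List.mem_append, List.mem_singleton,
      Set.mem_insert_iff]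
    constructor
    · rintro (⟨h1, h2⟩ | h1)
      · exact ⟨Or.inl h1, fun h3 => h3.elim (fun h => hxS (h ▸ h1)) h2⟩
      · exact ⟨Or.inr (Or.inl h1), fun h3 => h3.elim (fun h => hxl (h ▸ h1))
          fun h => hdl y h1 (hI.sub h)⟩
    · rintro ⟨h1 | h1 | h1, h2⟩
      · exact Or.inl ⟨h1, fun h => h2 (Or.inr h)⟩
      · exact Or.inr h1
      · exact absurd (Or.inl h1) h2
  · intro y hy
    rcases Finset.mem_insert.mp hy with rfl | hy
    · obtain ⟨d, hdm, hadj⟩ := exists_adj_last_of_isChain hc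
      rcases List.mem_cons.mp hdm with rfl | hdm
      · exact ⟨d, Finset.mem_union_left _ hh,
          fun hmem => (Finset.mem_insert.mp hmem).elim (fun h => hadj.ne h) hhL, hadj⟩
      · refine ⟨d, by simp [hdm], fun hmem => ?_, hadj⟩
        rcases Finset.mem_insert.mp hmem with h | h
        · exact hadj.ne h
        · exact hdl d hdm (hI.sub h)
    · obtain ⟨d, hdS, hdL, hadj⟩ := hI.nbr y hy
      exact ⟨d, Finset.mem_union_left _ hdS,
        fun hmem => (Finset.mem_insert.mp hmem).elim (fun h => hxS (h ▸ hdS)) hdL, hadj⟩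
  · intro y hy z hyz
    rcases Finset.mem_insert.mp hy with rfl | hy
    · rcases hm z hyz with h | h
      · exact Finset.mem_union_left _ h
      · exact Finset.mem_union_right _ (List.mem_toFinset.mpr h)
    · exact Finset.mem_union_left _ (hI.closed y hy z hyz)

end Leaves

/-! ### Moving tokens on two stacks -/

/-- Positions of tokens: a centre `r`, a waiting place `y` and two stacks `v` and `w`. -/
inductive Pos (t : ℕ)
  | r : Pos t
  | y : Pos t
  | v (j : Fin t) : Pos t
  | w (j : Fin t) : Pos t

/-- A configuration of tokens: the tokens `i` with `lo ≤ i < b` are on the stack `v`, the token `b`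
is moving and occupies all free positions, the tokens with `b < i ≤ hi` are on the stack `w`, and
`z` is the token at the waiting place, if any. -/
structure TokenState where
  lo : ℕ
  hi : ℕ
  b : ℕ
  z : Option ℕ

namespace TokenState

/-- The token that occupies a given position. -/
def own {t : ℕ} (s : TokenState) : Pos t → Option ℕ
  | .r => some s.b
  | .y => some (s.z.getD s.b)
  | .v j => if s.b ≤ j then some s.b else if s.lo ≤ j then some j else none
  | .w j => if j ≤ s.b then some s.b else if j ≤ s.hi then some j else none

/-- The interval of tokens is valid and does not contain the waiting token. -/
structure Valid (t : ℕ) (s : TokenState) : Prop where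
  lo_le : s.lo ≤ s.b
  le_hi : s.b ≤ s.hi
  hi_lt : s.hi < t
  wait_lt : ∀ a, s.z = some a → a < t
  wait_notMem : ∀ a, s.z = some a → s.lo ≤ a → s.hi < a

/-- Every token of `s'` has a position that it also occupies in `s`. -/
def Step (t : ℕ) (s s' : TokenState) : Prop :=
  ∀ i (q' : Pos t), s'.own q' = some i → ∃ q : Pos t, s.own q = some i ∧ s'.own q = some i

theorem Step.refl {t : ℕ} (s : TokenState) : Step t s s := fun _ q h => ⟨q, h, h⟩

theorem own_cases {t : ℕ} {s : TokenState} {q : Pos t} {i : ℕ} (h : s.own q = some i) :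
    i = s.b ∨ (s.lo ≤ i ∧ i < s.b) ∨ (s.b < i ∧ i ≤ s.hi) ∨ s.z = some i := by
  cases q with
  | r => simp only [own, Option.some.injEq] at h; omega
  | y =>
    simp only [own, Option.some.injEq] at h
    cases hz : s.z with
    | none => simp [hz] at h; omega
    | some a => simp [hz] at h; simp [h]
  | v j =>
    simp only [own] at h
    split_ifs at h with h1 h2 <;> simp only [Option.some.injEq] at h <;> omega
  | w j =>
    simp only [own] at h
    split_ifs at h with h1 h2 <;> simp only [Option.some.injEq] at h <;> omega

theorem own_v {t : ℕ} {s : TokenState} {j i : ℕ} (hj : j < t)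
    (h : (i = s.b ∧ s.b ≤ j) ∨ (i = j ∧ s.lo ≤ i ∧ i < s.b)) : s.own (Pos.v ⟨j, hj⟩) = some i := by
  simp only [own]
  split_ifs <;> congr 1 <;> omega

theorem own_w {t : ℕ} {s : TokenState} {j i : ℕ} (hj : j < t)
    (h : (i = s.b ∧ j ≤ s.b) ∨ (i = j ∧ s.b < i ∧ i ≤ s.hi)) : s.own (Pos.w ⟨j, hj⟩) = some i := by
  simp only [own]
  split_ifs <;> congr 1 <;> omega

/-- A token below both centres stays on `v`, and one above both stays on `w`. The token at the
centre also covers `v j` for `j ≥ b` and `w j` for `j ≤ b`, so it shares a position with whichever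
stack it settles on, and the next centre token still covers the place it came from. A token strictly
between the two centres would have to change stacks, which `hb` forbids. When no token waits, the
centre token covers `y` too and may be left there. -/
theorem step_of {t : ℕ} {s s' : TokenState} (hs' : s'.Valid t)
    (hlo : s.lo ≤ s'.lo) (hhi : s'.hi ≤ s.hi)
    (hb : ∀ i, s'.lo ≤ i → i ≤ s'.hi → ¬ (s.b < i ∧ i < s'.b) ∧ ¬ (s'.b < i ∧ i < s.b))
    (hz : s'.z = none ∨ s'.z = s.z ∨ (s.z = none ∧ s'.z = some s.b)) : Step t s s' := by
  intro i q' hq'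
  have h1' := hs'.lo_le
  have h2' := hs'.le_hi
  have h3' := hs'.hi_lt
  rcases own_cases hq' with h | ⟨h4, h5⟩ | ⟨h4, h5⟩ | h
  · subst h
    rcases lt_trichotomy s.b s'.b with hlt | heq | hlt
    · exact ⟨.w ⟨s'.b, by omega⟩, own_w _ (by omega), own_w _ (by omega)⟩
    · exact ⟨.r, by simp [own, heq], by simp [own]⟩
    · exact ⟨.v ⟨s'.b, by omega⟩, own_v _ (by omega), own_v _ (by omega)⟩
  · have := hb i h4 (by omega)
    exact ⟨.v ⟨i, by omega⟩, own_v _ (by omega), own_v _ (by omega)⟩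
  · have := hb i (by omega) h5
    exact ⟨.w ⟨i, by omega⟩, own_w _ (by omega), own_w _ (by omega)⟩
  · refine ⟨.y, ?_, by simp [own, h]⟩
    rcases hz with hz | hz | ⟨hz1, hz2⟩
    · simp [hz] at h
    · simp [own, ← hz, h]
    · rw [hz2] at h
      simpa [own, hz1] using h

/-- `l` is a sequence of valid states leading from the first state to the last by steps. -/
inductive Run (t : ℕ) : TokenState → List TokenState → TokenState → Prop
  | nil (s : TokenState) : Run t s [] s
  | cons {s s₁ s₂ : TokenState} {l : List TokenState} :
      s₁.Valid t → Step t s s₁ → Run t s₁ l s₂ → Run t s (s₁ :: l) s₂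

theorem Run.append {t : ℕ} {s s₁ s₂ : TokenState} {l l' : List TokenState} (h : Run t s l s₁)
    (h' : Run t s₁ l' s₂) : Run t s (l ++ l') s₂ := by
  induction h with
  | nil => exact h'
  | cons hv hs _ ih => exact Run.cons hv hs (ih h')

theorem Run.replicate {t : ℕ} {s : TokenState} (hs : s.Valid t) (n : ℕ) :
    Run t s (List.replicate n s) s := by
  induction n with
  | zero => exact Run.nil s
  | succ n ih => exact Run.cons hs (Step.refl s) ih

theorem valid_of_none {t lo hi b : ℕ} (h1 : lo ≤ b) (h2 : b ≤ hi) (h3 : hi < t) :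
    Valid t ⟨lo, hi, b, none⟩ :=
  ⟨h1, h2, h3, fun a h => by simp at h, fun a h => by simp at h⟩

/-- Moving all tokens between `b` and `e` past the centre, one after the other. -/
theorem exists_sweep {t lo hi b e : ℕ} {z : Option ℕ} (hb : Valid t ⟨lo, hi, b, z⟩)
    (he : Valid t ⟨lo, hi, e, z⟩) :
    ∃ l, Run t ⟨lo, hi, b, z⟩ l ⟨lo, hi, e, z⟩ ∧ l.length = (b - e) + (e - b) ∧
      (∀ x ∈ l, x.lo = lo ∧ x.hi = hi ∧ x.z = z) ∧
      ∀ j, (e ≤ j ∧ j < b ∨ b < j ∧ j ≤ e) → ∃ x ∈ l, x.b = j ∧ x.z = z := by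
  generalize hn : (b - e) + (e - b) = n
  induction n generalizing b with
  | zero =>
    obtain rfl : b = e := by omega
    exact ⟨[], Run.nil _, rfl, by simp, fun j hj => by omega⟩
  | succ n ih =>
    obtain ⟨h1, h2, h3, h4, h5⟩ := hb
    obtain ⟨g1, g2, g3, -, -⟩ := he
    simp only at h1 h2 h3 h4 h5 g1 g2 g3
    let b' := if b < e then b + 1 else b - 1
    have hb' : (b < e ∧ b' = b + 1) ∨ (e < b ∧ b' = b - 1) := by
      by_cases h : b < e
      · exact Or.inl ⟨h, by simp [b', h]⟩
      · exact Or.inr ⟨by omega, by simp [b', h]⟩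
    have hv : Valid t ⟨lo, hi, b', z⟩ := ⟨by simp; omega, by simp; omega, h3, h4, h5⟩
    obtain ⟨l, hl, hlen, hall, hj⟩ := ih hv (by omega)
    refine ⟨⟨lo, hi, b', z⟩ :: l, Run.cons hv ?_ hl, by simp [hlen], ?_, ?_⟩
    · refine step_of hv le_rfl le_rfl ?_ (Or.inr (Or.inl rfl))
      intro i _ _
      simp only
      omega
    · intro x hx
      rcases List.mem_cons.mp hx with rfl | hx
      · exact ⟨rfl, rfl, rfl⟩
      · exact hall x hx
    · intro j hjr
      by_cases hjb : j = b'
      · exact ⟨_, List.mem_cons_self, hjb.symm, rfl⟩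
      · obtain ⟨x, hx, hxb⟩ := hj j (by omega)
        exact ⟨x, List.mem_cons_of_mem _ hx, hxb⟩

/-- The token `b` at an end of the interval is put on the waiting place, meets all others and is
discarded. -/
theorem exists_round {t lo hi b : ℕ} (hlt : lo < hi) (hhi : hi < t) (hb : b = lo ∨ b = hi) :
    ∃ l lo' hi' e, Run t ⟨lo, hi, b, none⟩ l ⟨lo', hi', e, none⟩ ∧ l.length = hi - lo + 1 ∧
      lo ≤ lo' ∧ lo' ≤ hi' ∧ hi' ≤ hi ∧ hi' - lo' + 1 = hi - lo ∧ (e = lo' ∨ e = hi') ∧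
      (∀ x ∈ l, x.lo = lo' ∧ x.hi = hi') ∧
      (∀ i, lo ≤ i → i ≤ hi → ¬ (lo' ≤ i ∧ i ≤ hi') → i = b) ∧
      ∀ j, lo' ≤ j → j ≤ hi' → ∃ x ∈ l, x.z = some b ∧ x.b = j := by
  -- The token `b` leaves the interval, its neighbour `b₁` takes the centre, and the sweep runs to
  -- the opposite end `e`. The next round can therefore start at once from an end.
  obtain ⟨lo', hi', b₁, e, h⟩ : ∃ lo' hi' b₁ e,
      (b = hi ∧ lo' = lo ∧ hi' + 1 = hi ∧ b₁ + 1 = hi ∧ e = lo) ∨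
      (b = lo ∧ lo' = lo + 1 ∧ hi' = hi ∧ b₁ = lo + 1 ∧ e = hi) := by
    rcases hb with rfl | rfl
    · exact ⟨b + 1, hi, b + 1, hi, Or.inr ⟨rfl, rfl, rfl, rfl, rfl⟩⟩
    · exact ⟨lo, b - 1, b - 1, lo, Or.inl ⟨rfl, rfl, by omega, by omega, rfl⟩⟩
  have hv : ∀ d, lo' ≤ d → d ≤ hi' → Valid t ⟨lo', hi', d, some b⟩ := by
    intro d h1 h2
    refine ⟨h1, h2, by simp only; omega, ?_, ?_⟩
    · intro a ha
      simp only [Option.some.injEq] at ha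
      omega
    · intro a ha
      simp only [Option.some.injEq] at ha ⊢
      omega
  obtain ⟨l, hl, hlen, hall, hj⟩ := exists_sweep (hv b₁ (by omega) (by omega))
    (hv e (by omega) (by omega))
  have hve : Valid t ⟨lo', hi', e, none⟩ := valid_of_none (by omega) (by omega) (by omega)
  refine ⟨⟨lo', hi', b₁, some b⟩ :: (l ++ [⟨lo', hi', e, none⟩]), lo', hi', e,
    Run.cons (hv b₁ (by omega) (by omega)) ?_ (hl.append (Run.cons hve ?_ (Run.nil _))),
    ?_, by omega, by omega, by omega, by omega, by omega, ?_, by omega, ?_⟩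
  · refine step_of (hv b₁ (by omega) (by omega))
      (by simp only; omega) (by simp only; omega) ?_ (Or.inr (Or.inr ⟨rfl, rfl⟩))
    intro i _ _
    simp only at *
    omega
  · exact step_of hve le_rfl le_rfl
      (fun i _ _ => by simp only; omega) (Or.inl rfl)
  · simp only [List.length_cons, List.length_append, List.length_nil, hlen]
    omega
  · intro x hx
    simp only [List.mem_cons, List.mem_append, List.not_mem_nil, or_false] at hx
    rcases hx with rfl | hx | rfl
    · exact ⟨rfl, rfl⟩
    · exact ⟨(hall x hx).1, (hall x hx).2.1⟩
    · exact ⟨rfl, rfl⟩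
  · intro j h1 h2
    by_cases hjb : j = b₁
    · exact ⟨_, List.mem_cons_self, rfl, hjb.symm⟩
    · obtain ⟨x, hx, hxb, hxz⟩ := hj j (by omega)
      exact ⟨x, List.mem_cons_of_mem _ (List.mem_append_left _ hx), hxz, hxb⟩

/-- In one of the states of `l`, one of the tokens `i` and `j` is at the waiting place and the other
one is at the centre. -/
def Meets (l : List TokenState) (i j : ℕ) : Prop :=
  ∃ x ∈ l, (x.z = some i ∧ x.b = j) ∨ (x.z = some j ∧ x.b = i)

theorem Meets.mono {l l' : List TokenState} {i j : ℕ} (h : Meets l i j) (hl : l ⊆ l') :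
    Meets l' i j := by
  obtain ⟨x, hx, h⟩ := h
  exact ⟨x, hl hx, h⟩

/-- The tokens from `lo` to `hi` that are not between `lo'` and `hi'` meet all the others. -/
structure Progress (l : List TokenState) (lo hi lo' hi' : ℕ) : Prop where
  lo_le : lo ≤ lo'
  le : lo' ≤ hi'
  hi_le : hi' ≤ hi
  mem : ∀ x ∈ l, x.lo ≤ lo' ∧ hi' ≤ x.hi
  meets : ∀ i j, lo ≤ i → i ≤ hi → lo ≤ j → j ≤ hi → i ≠ j →
    ¬ ((lo' ≤ i ∧ i ≤ hi') ∧ (lo' ≤ j ∧ j ≤ hi')) → Meets l i j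

theorem Progress.idle {s : TokenState} {lo hi : ℕ} (h : lo ≤ hi) (h1 : s.lo ≤ lo) (h2 : hi ≤ s.hi)
    (n : ℕ) : Progress (List.replicate n s) lo hi lo hi :=
  ⟨le_rfl, h, le_rfl, fun x hx => by rw [List.eq_of_mem_replicate hx]; exact ⟨h1, h2⟩,
    fun i j _ _ _ _ _ hn => absurd ⟨⟨by assumption, by assumption⟩, by assumption, by assumption⟩ hn⟩

/-- With `N = hi - lo + 1` live tokens a round takes `N` steps, and `N * (N + 1) - (N - 1) * N = 2 *
N`. Thus `2 * n + N * (N + 1)` is preserved by full rounds. The only loss is the idle time at the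
end, too short for another round, of at most `hi' - lo'` steps. -/
theorem exists_run_of_end {t : ℕ} : ∀ {lo hi b : ℕ}, lo ≤ hi → hi < t → (b = lo ∨ b = hi) →
    ∀ n : ℕ, ∃ l s' lo' hi', Run t ⟨lo, hi, b, none⟩ l s' ∧ l.length = n ∧
      Progress l lo hi lo' hi' ∧
      (hi' = lo' ∨ 2 * n + (hi' - lo' + 1) * (hi' - lo' + 2) ≤
        (hi - lo + 1) * (hi - lo + 2) + 2 * (hi' - lo')) := by
  intro lo hi b
  induction hd : hi - lo using Nat.strong_induction_on generalizing lo hi b with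
  | _ d ih =>
  intro hle hhi hb n
  have hv : Valid t ⟨lo, hi, b, none⟩ := valid_of_none (by omega) (by omega) hhi
  -- A round takes `d + 1` steps; if it does not fit, the state is repeated.
  by_cases hn : lo = hi ∨ n ≤ d
  · refine ⟨List.replicate n ⟨lo, hi, b, none⟩, _, lo, hi, Run.replicate hv n, by simp,
      Progress.idle hle le_rfl le_rfl n, ?_⟩
    rcases hn with hn | hn
    · exact Or.inl hn.symm
    · right
      subst hd
      omega
  · obtain ⟨l, lo₁, hi₁, e, hrun, hlen, g1, g2, g3, g4, ge, gmem, gout, gmeet⟩ :=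
      exists_round (t := t) (lo := lo) (hi := hi) (b := b) (by omega) hhi hb
    obtain ⟨l', s', lo', hi', hrun', hlen', hP, hcost⟩ :=
      ih (hi₁ - lo₁) (by omega) rfl g2 (by omega) ge (n - (d + 1))
    refine ⟨l ++ l', s', lo', hi', hrun.append hrun', ?_, ⟨g1.trans hP.lo_le, hP.le,
      hP.hi_le.trans g3, ?_, ?_⟩, ?_⟩
    · rw [List.length_append, hlen, hlen']; omega
    · intro x hx
      rcases List.mem_append.mp hx with hx | hx
      · have := gmem x hx
        have := hP.lo_le
        have := hP.hi_le
        omega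
      · exact hP.mem x hx
    · intro i j hi1 hi2 hj1 hj2 hij hnot
      by_cases hi' : lo₁ ≤ i ∧ i ≤ hi₁
      · by_cases hj' : lo₁ ≤ j ∧ j ≤ hi₁
        · exact (hP.meets i j hi'.1 hi'.2 hj'.1 hj'.2 hij hnot).mono (List.subset_append_right _ _)
        · have hjb := gout j hj1 hj2 hj'
          obtain ⟨x, hx, hxz, hxb⟩ := gmeet i hi'.1 hi'.2
          exact ⟨x, List.mem_append_left _ hx, Or.inr ⟨hjb ▸ hxz, hxb⟩⟩
      · have hib := gout i hi1 hi2 hi'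
        have hj' : lo₁ ≤ j ∧ j ≤ hi₁ := by
          by_contra hj'
          exact hij (hib.trans (gout j hj1 hj2 hj').symm)
        obtain ⟨x, hx, hxz, hxb⟩ := gmeet j hj'.1 hj'.2
        exact ⟨x, List.mem_append_left _ hx, Or.inl ⟨hib ▸ hxz, hxb⟩⟩
    · rcases hcost with h | h
      · exact Or.inl h
      · right
        obtain ⟨k, rfl⟩ : ∃ k, d = k + 1 := ⟨hi₁ - lo₁, by omega⟩
        have hk : hi₁ - lo₁ = k := by omega
        rw [hk] at h
        obtain ⟨m, rfl⟩ : ∃ m, n = m + (k + 1 + 1) := ⟨n - (k + 1 + 1), by omega⟩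
        have : m + (k + 1 + 1) - (k + 1 + 1) = m := by omega
        rw [this] at h
        nlinarith

/-- A path may branch off at a copy in any state, so the centre must first be brought to the nearer
end of the interval. This takes at most half of `hi - lo + 1` steps, hence the additional term. The
first step also discards the waiting token and the tokens that are already finished. -/
theorem exists_run {t : ℕ} {s : TokenState} (hs : s.Valid t) {lo hi : ℕ} (hle : lo < hi)
    (hlo : s.lo ≤ lo) (hhi : hi ≤ s.hi) (n : ℕ) :
    ∃ l s' lo' hi', Run t s l s' ∧ l.length = n ∧ Progress l lo hi lo' hi' ∧
      (hi' = lo' ∨ 2 * n + (hi' - lo' + 1) * (hi' - lo' + 2) ≤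
        (hi - lo + 1) * (hi - lo + 2) + 2 * (hi' - lo') + (hi - lo + 1)) := by
  have hst := hs.hi_lt
  -- `e` is the end to be reached and `b₁` the centre after the first step. If `s.b` is strictly
  -- inside the interval, that step already moves by one towards the nearer end.
  obtain ⟨b₁, e, he, hb1, hb2, hbe, hbt⟩ : ∃ b₁ e, (e = lo ∨ e = hi) ∧ lo ≤ b₁ ∧ b₁ ≤ hi ∧
      2 * (1 + ((b₁ - e) + (e - b₁))) ≤ hi - lo + 1 ∧
      ∀ i, lo ≤ i → i ≤ hi → ¬ (s.b < i ∧ i < b₁) ∧ ¬ (b₁ < i ∧ i < s.b) := by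
    by_cases h1 : s.b ≤ lo
    · exact ⟨lo, lo, Or.inl rfl, le_rfl, hle.le, by omega, by omega⟩
    by_cases h2 : hi ≤ s.b
    · exact ⟨hi, hi, Or.inr rfl, hle.le, le_rfl, by omega, by omega⟩
    by_cases h3 : s.b - lo ≤ hi - s.b
    · exact ⟨s.b - 1, lo, Or.inl rfl, by omega, by omega, by omega, by omega⟩
    · exact ⟨s.b + 1, hi, Or.inr rfl, by omega, by omega, by omega, by omega⟩
  by_cases hn : n < 1 + ((b₁ - e) + (e - b₁))
  · exact ⟨List.replicate n s, s, lo, hi, Run.replicate hs n, by simp,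
      Progress.idle hle.le hlo hhi n, Or.inr (by omega)⟩
  · have hv1 : Valid t ⟨lo, hi, b₁, none⟩ := valid_of_none hb1 hb2 (by omega)
    have hve : Valid t ⟨lo, hi, e, none⟩ := valid_of_none (by omega) (by omega) (by omega)
    obtain ⟨l, hl, hlen, hall, -⟩ := exists_sweep hv1 hve
    obtain ⟨l', s', lo', hi', hrun', hlen', hP, hcost⟩ :=
      exists_run_of_end (t := t) hle.le (by omega) he (n - (1 + ((b₁ - e) + (e - b₁))))
    have hstep : Step t s ⟨lo, hi, b₁, none⟩ := step_of hv1 hlo hhi hbt (Or.inl rfl)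
    have := hP.lo_le
    have := hP.hi_le
    refine ⟨⟨lo, hi, b₁, none⟩ :: (l ++ l'), s', lo', hi',
      Run.cons hv1 hstep (hl.append hrun'), ?_, ⟨hP.lo_le, hP.le, hP.hi_le, ?_, ?_⟩, ?_⟩
    · simp only [List.length_cons, List.length_append, hlen, hlen']
      omega
    · intro x hx
      rcases List.mem_cons.mp hx with rfl | hx
      · simp only; omega
      · rcases List.mem_append.mp hx with hx | hx
        · have := hall x hx
          omega
        · exact hP.mem x hx
    · intro i j hi1 hi2 hj1 hj2 hij hnot
      exact (hP.meets i j hi1 hi2 hj1 hj2 hij hnot).mono fun x hx =>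
        List.mem_cons_of_mem _ (List.mem_append_right _ hx)
    · rcases hcost with h | h
      · exact Or.inl h
      · right
        omega

end TokenState

/-! ### Clique minors of products from balance -/

section Balance

variable {V W : Type*} {G : SimpleGraph V} {H : SimpleGraph W}

/-- A vertex `r` has a neighbour `y` and two disjoint sets of at least `t` vertices that avoid `r`
and `y` and are connected together with `r`. -/
def HasBalance (G : SimpleGraph V) (t : ℕ) : Prop :=
  ∃ (r y : V) (A B : Set V), G.Adj r y ∧ r ∉ A ∧ r ∉ B ∧ y ∉ A ∧ y ∉ B ∧ Disjoint A B ∧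
    (G.induce (insert r A)).Connected ∧ (G.induce (insert r B)).Connected ∧
    t ≤ A.ncard ∧ t ≤ B.ncard

/-- A realisation of the positions of tokens by vertices of `G`. -/
structure IsFrame {t : ℕ} (G : SimpleGraph V) (e : Pos t → V) : Prop where
  injective : Function.Injective e
  adj : G.Adj (e .r) (e .y)
  conn_v : ∀ b, (G.induce {x | x = e .r ∨ ∃ j : Fin t, b ≤ (j : ℕ) ∧ x = e (.v j)}).Connected
  conn_w : ∀ b, (G.induce {x | x = e .r ∨ ∃ j : Fin t, (j : ℕ) ≤ b ∧ x = e (.w j)}).Connected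

/-- Both stacks are grown from `r` one vertex at a time. The stack `v` is numbered backwards, so
that the positions `v j` with `b ≤ j`, like the `w j` with `j ≤ b`, form an initial segment of the
growth and are connected through `r`. -/
theorem HasBalance.exists_isFrame [Finite V] {t : ℕ} (h : HasBalance G t) :
    ∃ e : Pos t → V, IsFrame G e := by
  obtain ⟨r, y, A, B, hry, hrA, hrB, hyA, hyB, hAB, hA, hB, htA, htB⟩ := h
  obtain ⟨f, hfi, hfA, hfc⟩ := exists_growth hrA hA t htA
  obtain ⟨g, hgi, hgB, hgc⟩ := exists_growth hrB hB t htB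
  rw [Set.disjoint_left] at hAB
  refine ⟨fun p => match p with
    | .r => r
    | .y => y
    | .v j => f (t - 1 - j)
    | .w j => g j, ?_, hry, ?_, ?_⟩
  · have h1 : ∀ j : Fin t, f (t - 1 - j) ∈ A := fun j => hfA _ (by omega)
    have h2 : ∀ j : Fin t, g j ∈ B := fun j => hgB _ j.2
    rintro (_ | _ | i | i) (_ | _ | j | j) hij <;> simp only at hij
    · rfl
    · exact absurd hij hry.ne
    · exact absurd (hij ▸ h1 j) hrA
    · exact absurd (hij ▸ h2 j) hrB
    · exact absurd hij hry.ne'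
    · rfl
    · exact absurd (hij ▸ h1 j) hyA
    · exact absurd (hij ▸ h2 j) hyB
    · exact absurd (hij ▸ h1 i) hrA
    · exact absurd (hij ▸ h1 i) hyA
    · have := hfi (by simp only [Set.mem_Iio]; omega) (by simp only [Set.mem_Iio]; omega) hij
      congr 1
      omega
    · exact absurd (h2 j) (hij ▸ hAB (h1 i))
    · exact absurd (hij ▸ h2 i) hrB
    · exact absurd (hij ▸ h2 i) hyB
    · exact absurd (h2 i) (hij ▸ hAB (h1 j))
    · have := hgi (by simp) (by simp) hij
      congr 1
      omega
  · intro b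
    refine Connected.induce_congr (hfc (t - b) (by omega)) ?_
    ext x
    simp only [Set.mem_ofPred_eq]
    refine or_congr_right ⟨?_, ?_⟩
    · rintro ⟨j, hj, rfl⟩
      exact ⟨⟨t - 1 - j, by omega⟩, by simp only; omega, by congr 1; simp only; omega⟩
    · rintro ⟨j, hj, rfl⟩
      exact ⟨t - 1 - j, by omega, rfl⟩
  · intro b
    refine Connected.induce_congr (hgc (min t (b + 1)) (by omega)) ?_
    ext x
    simp only [Set.mem_ofPred_eq]
    refine or_congr_right ⟨?_, ?_⟩
    · rintro ⟨j, hj, rfl⟩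
      exact ⟨⟨j, by omega⟩, by simp only; omega, rfl⟩
    · rintro ⟨j, hj, rfl⟩
      exact ⟨j, by omega, rfl⟩

open TokenState

/-- The vertices occupied by the token `i`. -/
def piece {t : ℕ} (e : Pos t → V) (s : TokenState) (i : ℕ) : Set V :=
  {x | ∃ q, e q = x ∧ s.own q = some i}

/-- The moving token holds `r` and the segments of both stacks next to `r`, and possibly `y`. Every
other token holds a single position: by `wait_notMem` the waiting token is not on a stack. -/
theorem IsFrame.connected_piece {t : ℕ} {e : Pos t → V} (he : IsFrame G e) {s : TokenState}
    (hs : s.Valid t) {i : ℕ} (hi : (piece e s i).Nonempty) :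
    (G.induce (piece e s i)).Connected := by
  have h1 := hs.lo_le
  have h2 := hs.le_hi
  by_cases hib : i = s.b
  · subst hib
    have hvw := SimpleGraph.induce_union_connected (he.conn_v s.b).preconnected
      (he.conn_w s.b).preconnected ⟨e .r, Or.inl rfl, Or.inl rfl⟩
    refine connected_induce_of_core hvw ?_ ?_
    · rintro x ((rfl | ⟨j, hj, rfl⟩) | (rfl | ⟨j, hj, rfl⟩))
      · exact ⟨_, rfl, rfl⟩
      · exact ⟨_, rfl, own_v j.2 (Or.inl ⟨rfl, hj⟩)⟩
      · exact ⟨_, rfl, rfl⟩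
      · exact ⟨_, rfl, own_w j.2 (Or.inl ⟨rfl, hj⟩)⟩
    · rintro _ ⟨q, rfl, hq⟩
      cases q with
      | r =>
        exact ⟨{e .r}, by rintro _ rfl; exact ⟨_, rfl, rfl⟩, rfl, connected_induce_singleton _,
          ⟨e .r, rfl, Or.inl (Or.inl rfl)⟩⟩
      | y =>
        refine ⟨{e .r, e .y}, ?_, Or.inr rfl, SimpleGraph.induce_pair_connected_of_adj he.adj,
          ⟨e .r, Or.inl rfl, Or.inl (Or.inl rfl)⟩⟩
        rintro _ (rfl | rfl)
        · exact ⟨_, rfl, rfl⟩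
        · exact ⟨_, rfl, hq⟩
      | v j =>
        refine ⟨{e (.v j)}, by rintro _ rfl; exact ⟨_, rfl, hq⟩, rfl,
          connected_induce_singleton _, ⟨_, rfl, Or.inl (Or.inr ⟨j, ?_, rfl⟩)⟩⟩
        simp only [own] at hq
        split_ifs at hq with g1 g2 <;> simp only [Option.some.injEq] at hq <;> omega
      | w j =>
        refine ⟨{e (.w j)}, by rintro _ rfl; exact ⟨_, rfl, hq⟩, rfl,
          connected_induce_singleton _, ⟨_, rfl, Or.inr (Or.inr ⟨j, ?_, rfl⟩)⟩⟩
        simp only [own] at hq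
        split_ifs at hq with g1 g2 <;> simp only [Option.some.injEq] at hq <;> omega
  · obtain ⟨x, q₀, rfl, hq₀⟩ := hi
    have huniq : ∀ q : Pos t, s.own q = some i → q = q₀ := by
      have hw := hs.wait_notMem
      have hy : ∀ a : ℕ, s.z.getD s.b = a → a = s.b ∨ s.z = some a := by
        intro a ha
        cases hz : s.z with
        | none => left; simp [hz] at ha; omega
        | some c => right; simp [hz] at ha; simp [ha]
      intro q hq
      have hwi := hw i
      have hyi := hy i
      cases q <;> cases q₀ <;> simp only [own, Option.some.injEq] at hq hq₀ <;>
        (try split_ifs at hq with g1 g2) <;> (try split_ifs at hq₀ with g3 g4) <;>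
        (try simp only [Option.some.injEq] at hq hq₀) <;>
        first
          | rfl
          | (exfalso; omega)
          | (congr 1; omega)
          | (rcases hyi (by assumption) with h | h
             · omega
             · have := hwi h; omega)
    refine Connected.induce_congr (connected_induce_singleton (e q₀)) ?_
    ext x
    constructor
    · rintro rfl
      exact ⟨_, rfl, hq₀⟩
    · rintro ⟨q, rfl, hq⟩
      rw [huniq q hq]
      rfl

/-- The vertices of the product occupied by the token `i`, if the state `σ h` is used in the copy of
`G` at each `h ∈ S`. -/
def tokens {t : ℕ} (e : Pos t → V) (σ : W → TokenState) (S : Set W) (i : ℕ) : Set (V × W) :=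
  {x | x.2 ∈ S ∧ x.1 ∈ piece e (σ x.2) i}

theorem connected_slice {s : Set V} (hs : (G.induce s).Connected) (h : W) :
    ((G.boxProd H).induce {x | x.1 ∈ s ∧ x.2 = h}).Connected := by
  refine Connected.induce_congr
    (connected_induce_image (G' := G.boxProd H) (G.boxProdLeft H h).toHom hs) ?_
  ext ⟨a, b⟩
  simp [SimpleGraph.boxProdLeft, eq_comm]

/-- The states of the run are put on the successive vertices of the path. A step leaves each
surviving token a position common to the two adjacent copies, so its trace stays connected; a token
that has disappeared keeps its old trace. -/
theorem IsFrame.extend_run {t : ℕ} {e : Pos t → V} (he : IsFrame G e) {s s' : TokenState}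
    {l : List TokenState} (hrun : Run t s l s') :
    ∀ {S : Set W} {σ : W → TokenState} {h : W} {hs : List W}, h ∈ S → σ h = s →
      (∀ i < t, ((G.boxProd H).induce (tokens e σ S i)).Connected) →
      List.IsChain H.Adj (h :: hs) → hs.Nodup → (∀ x ∈ hs, x ∉ S) → hs.length = l.length →
      ∃ σ' : W → TokenState, (∀ x ∈ S, σ' x = σ x) ∧
        (∀ i < t, ((G.boxProd H).induce (tokens e σ' (S ∪ {x | x ∈ hs}) i)).Connected) ∧
        (∀ x ∈ l, ∃ h ∈ hs, σ' h = x) ∧ (∀ h ∈ hs, σ' h ∈ l ∧ (σ' h).Valid t) := by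
  classical
  induction hrun with
  | nil s =>
    intro S σ h hs hh hσ hconn hc hn hd hlen
    obtain rfl : hs = [] := List.eq_nil_of_length_eq_zero (by simpa using hlen)
    exact ⟨σ, fun _ _ => rfl, fun i hi => Connected.induce_congr (hconn i hi) (by simp), by simp,
      by simp⟩
  | @cons s s₁ s₂ l hv hstep _ ih =>
    intro S σ h hs hh hσ hconn hc hn hd hlen
    obtain ⟨a, hs, rfl⟩ : ∃ a hs', hs = a :: hs' := by
      cases hs with
      | nil => simp at hlen
      | cons a hs => exact ⟨a, hs, rfl⟩
    rw [List.isChain_cons_cons] at hc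
    rw [List.nodup_cons] at hn
    have haS : a ∉ S := hd a (by simp)
    have hupd : ∀ x ∈ S, Function.update σ a s₁ x = σ x := fun x hx =>
      Function.update_of_ne (by rintro rfl; exact haS hx) _ _
    have hconn' : ∀ i < t, ((G.boxProd H).induce
        (tokens e (Function.update σ a s₁) (insert a S) i)).Connected := by
      intro i hi
      have heq : tokens e (Function.update σ a s₁) (insert a S) i =
          tokens e σ S i ∪ {x | x.1 ∈ piece e s₁ i ∧ x.2 = a} := by
        ext ⟨x, y⟩
        simp only [tokens, Set.mem_ofPred_eq, Set.mem_insert_iff, Set.mem_union]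
        constructor
        · rintro ⟨rfl | hy, hx⟩
          · rw [Function.update_self] at hx
            exact Or.inr ⟨hx, rfl⟩
          · rw [hupd y hy] at hx
            exact Or.inl ⟨hy, hx⟩
        · rintro (⟨hy, hx⟩ | ⟨hx, rfl⟩)
          · exact ⟨Or.inr hy, by rwa [hupd y hy]⟩
          · exact ⟨Or.inl rfl, by rwa [Function.update_self]⟩
      rw [heq]
      by_cases hne : (piece e s₁ i).Nonempty
      · obtain ⟨_, q', rfl, hq'⟩ := hne
        obtain ⟨q, hq, hq1⟩ := hstep i q' hq'
        exact SimpleGraph.connected_induce_union (hconn i hi).preconnected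
          (connected_slice (he.connected_piece hv ⟨_, q', rfl, hq'⟩) a).preconnected
          (v := (e q, h)) (w := (e q, a)) ⟨hh, q, rfl, hσ ▸ hq⟩ ⟨⟨q, rfl, hq1⟩, rfl⟩
          (Or.inr ⟨hc.1, rfl⟩)
      · refine Connected.induce_congr (hconn i hi) ?_
        rw [Set.not_nonempty_iff_eq_empty] at hne
        simp [hne]
    obtain ⟨σ', h1, h2, h3, h4⟩ := ih (S := insert a S) (σ := Function.update σ a s₁) (h := a)
      (hs := hs) (Set.mem_insert _ _) (Function.update_self ..) hconn' hc.2 hn.2 (by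
        rintro x hx (rfl | hxS)
        · exact hn.1 hx
        · exact hd x (List.mem_cons_of_mem _ hx) hxS) (by simpa using hlen)
    have ha : σ' a = s₁ := by rw [h1 a (Set.mem_insert _ _), Function.update_self]
    refine ⟨σ', fun x hx => ?_, fun i hi => ?_, ?_, ?_⟩
    · rw [h1 x (Set.mem_insert_of_mem _ hx), hupd x hx]
    · refine Connected.induce_congr (h2 i hi) ?_
      congr 1
      ext x
      simp only [Set.mem_union, Set.mem_insert_iff, Set.mem_ofPred_eq, List.mem_cons]
      tauto
    · intro x hx
      rcases List.mem_cons.mp hx with rfl | hx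
      · exact ⟨a, by simp, ha⟩
      · obtain ⟨b, hb, hbx⟩ := h3 x hx
        exact ⟨b, List.mem_cons_of_mem _ hb, hbx⟩
    · intro x hx
      rcases List.mem_cons.mp hx with rfl | hx
      · exact ⟨by rw [ha]; simp, by rw [ha]; exact hv⟩
      · exact ⟨List.mem_cons_of_mem _ (h4 x hx).1, (h4 x hx).2⟩

/-- The tokens outside the interval from `lo` to `hi` have met all other tokens in `S`. -/
structure Schedule {t : ℕ} (G : SimpleGraph V) (H : SimpleGraph W) (e : Pos t → V)
    (σ : W → TokenState) (S L : Finset W) (lo hi : ℕ) : Prop where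
  leaves : LeafInv H S L
  le : lo ≤ hi
  lt : hi < t
  conn : ∀ i < t, ((G.boxProd H).induce (tokens e σ S i)).Connected
  valid : ∀ h ∈ S, (σ h).Valid t ∧ (σ h).lo ≤ lo ∧ hi ≤ (σ h).hi
  meets : ∀ i j, i < t → j < t → i ≠ j → ¬ ((lo ≤ i ∧ i ≤ hi) ∧ (lo ≤ j ∧ j ≤ hi)) →
    ∃ h ∈ S, ((σ h).z = some i ∧ (σ h).b = j) ∨ ((σ h).z = some j ∧ (σ h).b = i)

/-- With one token left in the interval no pair is exempt from meeting, and a meeting is an edge of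
the product between positions `r` and `y` of one copy. -/
theorem Schedule.isMinor {t : ℕ} {e : Pos t → V} (he : IsFrame G e) {σ : W → TokenState}
    {S L : Finset W} {lo : ℕ} (h : Schedule G H e σ S L lo lo) :
    IsMinor (⊤ : SimpleGraph (Fin t)) (G.boxProd H) := by
  refine isMinor_top_of_family (by simp) (fun i : Fin t => tokens e σ S i)
    (fun i => h.conn i i.2) ?_ ?_
  · intro i j hij
    rw [Set.disjoint_left]
    rintro ⟨_, y⟩ ⟨-, q, rfl, hq⟩ ⟨-, q', hqq, hq'⟩
    rw [he.injective hqq] at hq'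
    simp only at hq hq'
    rw [hq] at hq'
    exact hij (Fin.ext (by simpa using hq'))
  · intro i j hij
    have hij' : (i : ℕ) ≠ j := fun h => hij (Fin.ext h)
    obtain ⟨x, hx, ⟨hz, hb⟩ | ⟨hz, hb⟩⟩ := h.meets i j i.2 j.2 hij' (by omega)
    · exact ⟨(e .y, x), ⟨hx, .y, rfl, by simp [own, hz]⟩, (e .r, x), ⟨hx, .r, rfl, by simp [own, hb]⟩,
        Or.inl ⟨he.adj.symm, rfl⟩⟩
    · exact ⟨(e .r, x), ⟨hx, .r, rfl, by simp [own, hb]⟩, (e .y, x), ⟨hx, .y, rfl, by simp [own, hz]⟩,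
        Or.inl ⟨he.adj, rfl⟩⟩

/-- The graph `H` is searched by maximal paths and the tokens are processed along each of them. In
the inequality, `(hi - lo + 1) * (hi - lo + 2)` is the work still to be done, doubled. The summand
`2` pays for the initial vertex, and each leaf, that is each path, pays for a waste of at most `3 *
t - 2`. -/
theorem exists_schedule [Fintype W] {t : ℕ} (ht : 0 < t) {e : Pos t → V} (he : IsFrame G e)
    (hH : H.Connected) :
    ∃ σ S L lo hi, Schedule G H e σ S L lo hi ∧ (lo = hi ∨ (Fintype.card W = S.card ∧ lo < hi ∧
      2 * S.card + (hi - lo + 1) * (hi - lo + 2) ≤ t * (t + 1) + 2 + L.card * (3 * t - 2))) := by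
  classical
  have hstart : ∃ σ S L lo hi, Schedule G H e σ S L lo hi ∧ S.Nonempty ∧
      2 * S.card + (hi - lo + 1) * (hi - lo + 2) ≤ t * (t + 1) + 2 + L.card * (3 * t - 2) := by
    obtain ⟨a⟩ := hH.nonempty
    have hv : Valid t ⟨0, t - 1, 0, none⟩ := valid_of_none le_rfl (by omega) (by omega)
    refine ⟨fun _ => ⟨0, t - 1, 0, none⟩, {a}, ∅, 0, t - 1,
      ⟨LeafInv.singleton a, by omega, by omega, ?_, ?_, ?_⟩, by simp, ?_⟩
    · intro i hi
      refine Connected.induce_congr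
        (connected_slice (H := H) (he.connected_piece hv (i := i) ?_) a) ?_
      · by_cases h0 : i = 0
        · exact ⟨e .r, .r, rfl, by simp [own, h0]⟩
        · refine ⟨_, .w ⟨i, hi⟩, rfl, own_w hi ?_⟩
          exact Or.inr ⟨rfl, Nat.pos_of_ne_zero h0, Nat.le_sub_one_of_lt hi⟩
      · ext ⟨x, y⟩
        simp [tokens, and_comm]
    · intro h _
      exact ⟨hv, le_rfl, le_rfl⟩
    · intro i j hi hj hij hn
      omega
    · obtain ⟨u, rfl⟩ : ∃ u, t = u + 1 := ⟨t - 1, by omega⟩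
      simp only [Finset.card_singleton, Finset.card_empty, Nat.add_sub_cancel, Nat.sub_zero]
      nlinarith
  obtain ⟨σ, S, L, lo, hi, hS, hne, hcost⟩ := hstart
  induction hk : Fintype.card W - S.card using Nat.strong_induction_on generalizing σ S L lo hi with
  | _ k ih =>
  by_cases hend : lo = hi
  · exact ⟨σ, S, L, lo, hi, hS, Or.inl hend⟩
  have hlt : lo < hi := lt_of_le_of_ne hS.le hend
  by_cases hall : ∀ x, x ∈ S
  · refine ⟨σ, S, L, lo, hi, hS, Or.inr ⟨?_, hlt, hcost⟩⟩
    rw [Finset.eq_univ_iff_forall.mpr hall, Finset.card_univ]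
  push Not at hall
  obtain ⟨h, hh, l, x, hc, hn, hd, hm⟩ := exists_maximal_path hH hne hall
  -- Every unfinished token is present in every explored copy, so the process can resume at any `h`.
  obtain ⟨hv, hv1, hv2⟩ := hS.valid h hh
  obtain ⟨ls, s', lo', hi', hrun, hlen, hP, hcost'⟩ := exists_run hv hlt hv1 hv2 (l ++ [x]).length
  obtain ⟨σ', h1, h2, h3, h4⟩ := he.extend_run (H := H) hrun (S := (S : Set W)) (σ := σ) (h := h)
    (hs := l ++ [x]) hh rfl hS.conn hc hn (fun y hy => hd y hy) hlen.symm
  have g1 := hP.lo_le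
  have g2 := hP.le
  have g3 := hP.hi_le
  have hS' : Schedule G H e σ' (S ∪ (l ++ [x]).toFinset) (insert x L) lo' hi' := by
    refine ⟨hS.leaves.extend hh hc hn hd hm, g2, g3.trans_lt hS.lt, ?_, ?_, ?_⟩
    · intro i hi
      refine Connected.induce_congr (h2 i hi) ?_
      congr 1
      ext y
      simp only [Finset.coe_union, List.coe_toFinset]
    · intro y hy
      rcases Finset.mem_union.mp hy with hy | hy
      · rw [h1 y hy]
        have := hS.valid y hy
        exact ⟨this.1, by omega, by omega⟩
      · have := h4 y (List.mem_toFinset.mp hy)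
        exact ⟨this.2, hP.mem _ this.1⟩
    · intro i j hit hjt hij hnot
      by_cases hold : (lo ≤ i ∧ i ≤ hi) ∧ (lo ≤ j ∧ j ≤ hi)
      · obtain ⟨y, hy, hyij⟩ := hP.meets i j hold.1.1 hold.1.2 hold.2.1 hold.2.2 hij hnot
        obtain ⟨z, hz, rfl⟩ := h3 y hy
        exact ⟨z, Finset.mem_union_right _ (List.mem_toFinset.mpr hz), hyij⟩
      · obtain ⟨y, hy, hyij⟩ := hS.meets i j hit hjt hij hold
        exact ⟨y, Finset.mem_union_left _ hy, by rwa [h1 y hy]⟩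
  have hdisj : Disjoint S (l ++ [x]).toFinset := by
    rw [Finset.disjoint_right]
    intro y hy
    exact hd y (List.mem_toFinset.mp hy)
  have hScard : (S ∪ (l ++ [x]).toFinset).card = S.card + (l ++ [x]).length := by
    rw [Finset.card_union_of_disjoint hdisj, List.toFinset_card_of_nodup hn]
  have hxL : x ∉ L := fun hx => hd x (by simp) (hS.leaves.sub hx)
  have hLcard : (insert x L).card = L.card + 1 := Finset.card_insert_of_notMem hxL
  have hle := Finset.card_le_univ (S ∪ (l ++ [x]).toFinset)
  have hpos : 0 < (l ++ [x]).length := by simp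
  by_cases hend' : hi' = lo'
  · exact ⟨_, _, _, lo', hi', hS', Or.inl hend'.symm⟩
  · refine ih _ ?_ σ' _ _ lo' hi' hS' (hne.mono Finset.subset_union_left) ?_ rfl
    · omega
    · rcases hcost' with h | h
      · exact absurd h hend'
      have hmul : (L.card + 1) * (3 * t - 2) = L.card * (3 * t - 2) + (3 * t - 2) := by ring
      rw [hScard, hLcard, hmul]
      -- The waste `2 * (hi' - lo') + (hi - lo + 1)` is at most `2 * (t - 1) + t`, since `hi < t`.
      have := hS.lt
      omega

/-- If `G` is balanced and the numbers of leaves in `H` are bounded, then the product with a large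
graph `H` has a large clique minor. -/
theorem HasBalance.isMinor [Finite V] [Fintype W] {c : ℕ} (h : HasBalance G (c + 1))
    (hH : H.Connected) (hcard : 2 * c ^ 2 + 2 ≤ Fintype.card W + c)
    (hleaf : ∀ S L, LeafInv H S L → L.card + 2 ≤ c) :
    IsMinor (⊤ : SimpleGraph (Fin (c + 1))) (G.boxProd H) := by
  obtain ⟨e, he⟩ := h.exists_isFrame
  obtain ⟨σ, S, L, lo, hi, hS, rfl | ⟨hSc, hlt, hcost⟩⟩ := exists_schedule (by omega) he hH
  · exact hS.isMinor he
  · exfalso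
    have hL := hleaf S L hS.leaves
    obtain ⟨q, rfl⟩ : ∃ q, c = q + 2 := ⟨c - 2, by omega⟩
    -- At least two tokens remain, so the work left is at least `6`. With `t = c + 1` and at most `c
    -- - 2` leaves, `2 * |H| + 6 ≤ (c + 1) * (c + 2) + 2 + (c - 2) * (3 * c + 1) = 4 * c ^ 2 - 2 * c
    -- + 2`, against `2 * |H| ≥ 4 * c ^ 2 - 2 * c + 4`.
    have h1 : L.card * (3 * (q + 2 + 1) - 2) ≤ q * (3 * q + 7) := by
      have : 3 * (q + 2 + 1) - 2 = 3 * q + 7 := by omega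
      rw [this]
      exact Nat.mul_le_mul_right _ (by omega)
    rw [← hSc] at hcost
    nlinarith

end Balance

/-! ### Few leaves force a long path -/

section LongPath

variable {V : Type*} {G : SimpleGraph V}

/-- Neither end of a longest path has a neighbour off the path, so both ends can serve as leaves.
This starts the search with two leaves instead of none. -/
theorem LeafInv.of_longest_path [Fintype V] [DecidableEq V] {a b x : V} {l : List V}
    (hc : List.IsChain G.Adj (a :: b :: (l ++ [x]))) (hn : (a :: b :: (l ++ [x])).Nodup)
    (hmax : ∀ q : List V, List.IsChain G.Adj q → q.Nodup →
      q.length ≤ (a :: b :: (l ++ [x])).length) :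
    LeafInv G (a :: b :: (l ++ [x])).toFinset {a, x} := by
  have hn' := hn
  simp only [List.nodup_cons, List.mem_cons, List.mem_append, List.not_mem_nil, or_false, not_or,
    List.nodup_append] at hn'
  obtain ⟨⟨hab, hal, hax⟩, ⟨hbl, hbx⟩, hln, -, hlx⟩ := hn'
  have hxl : x ∉ l := fun h => hlx x h x rfl rfl
  have hc' := hc
  rw [List.isChain_cons_cons] at hc'
  have hcl : List.IsChain G.Adj (b :: l) := by
    have := hc'.2
    rw [← List.cons_append] at this
    exact this.left_of_append
  refine ⟨?_, ?_, ?_, ?_⟩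
  · intro y hy
    simp only [Finset.mem_insert, Finset.mem_singleton] at hy
    rcases hy with rfl | rfl <;> simp
  · refine Connected.induce_congr
      (connected_induce_union_chain (connected_induce_singleton b) rfl hcl) ?_
    ext y
    simp only [Set.mem_union, Set.mem_singleton_iff, Set.mem_ofPred_eq, Set.mem_sdiff,
      List.coe_toFinset, List.mem_cons, List.mem_append, List.not_mem_nil, or_false,
      Finset.coe_insert, Finset.coe_singleton, Set.mem_insert_iff, not_or]
    constructor
    · rintro (rfl | hy)
      · exact ⟨Or.inr (Or.inl rfl), fun h => hab h.symm, hbx⟩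
      · exact ⟨Or.inr (Or.inr (Or.inl hy)), fun h => hal (h ▸ hy), fun h => hxl (h ▸ hy)⟩
    · rintro ⟨h1, h2, h3⟩
      tauto
  · intro y hy
    simp only [Finset.mem_insert, Finset.mem_singleton] at hy
    rcases hy with rfl | rfl
    · refine ⟨b, by simp, ?_, hc'.1.symm⟩
      simp only [Finset.mem_insert, Finset.mem_singleton, not_or]
      exact ⟨fun h => hab h.symm, hbx⟩
    · obtain ⟨d, hd, hadj⟩ := exists_adj_last_of_isChain hc'.2
      refine ⟨d, ?_, ?_, hadj⟩
      · simp only [List.mem_toFinset, List.mem_cons, List.mem_append]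
        rw [List.mem_cons] at hd
        tauto
      · simp only [Finset.mem_insert, Finset.mem_singleton, not_or]
        refine ⟨?_, hadj.ne⟩
        rintro rfl
        rcases List.mem_cons.mp hd with h | h
        · exact hab h
        · exact hal h
  · intro y hy z hyz
    rw [List.mem_toFinset]
    by_contra hz
    simp only [Finset.mem_insert, Finset.mem_singleton] at hy
    rcases hy with rfl | rfl
    · have := hmax (z :: y :: b :: (l ++ [x]))
        (by rw [List.isChain_cons_cons]; exact ⟨hyz.symm, hc⟩)
        (by rw [List.nodup_cons]; exact ⟨hz, hn⟩)
      simp at this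
    · have := hmax ((a :: b :: (l ++ [y])) ++ [z]) ?_ ?_
      · simp at this
      · rw [List.isChain_append]
        refine ⟨hc, List.isChain_singleton _, ?_⟩
        intro p hp q hq
        have h1 : a :: b :: (l ++ [y]) = (a :: b :: l) ++ [y] := rfl
        rw [h1, List.getLast?_concat] at hp
        obtain rfl : y = p := by simpa using hp
        obtain rfl : z = q := by simpa using hq
        exact hyz
      · rw [List.nodup_append]
        refine ⟨hn, by simp, ?_⟩
        rintro p hp q hq rfl
        rw [List.mem_singleton] at hq
        exact hz (hq ▸ hp)

theorem exists_longest_path [Fintype V] (hG : G.Connected) (hV : 3 ≤ Fintype.card V) :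
    ∃ (a b x : V) (l : List V), List.IsChain G.Adj (a :: b :: (l ++ [x])) ∧
      (a :: b :: (l ++ [x])).Nodup ∧ ∀ q : List V, List.IsChain G.Adj q → q.Nodup →
        q.length ≤ (a :: b :: (l ++ [x])).length := by
  classical
  obtain ⟨a₀⟩ := hG.nonempty
  let P : ℕ → Prop := fun n => ∃ q : List V, List.IsChain G.Adj q ∧ q.Nodup ∧ q.length = n
  have hP : ∀ n, P n → n ≤ Fintype.card V := by
    rintro n ⟨q, -, hq, rfl⟩
    exact hq.length_le_card
  have hP1 : P 1 := ⟨[a₀], List.isChain_singleton _, by simp, rfl⟩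
  obtain ⟨q, hqc, hqn, hql⟩ : P (Nat.findGreatest P (Fintype.card V)) :=
    Nat.findGreatest_spec (hP 1 hP1) hP1
  have hmax : ∀ q' : List V, List.IsChain G.Adj q' → q'.Nodup → q'.length ≤ q.length := by
    intro q' h1 h2
    rw [hql]
    exact Nat.le_findGreatest (hP _ ⟨q', h1, h2, rfl⟩) ⟨q', h1, h2, rfl⟩
  have hclosed : ∀ a l, q = a :: l → ∀ z, G.Adj a z → z ∈ q := by
    rintro a l rfl z haz
    by_contra hz
    have := hmax (z :: a :: l) (by rw [List.isChain_cons_cons]; exact ⟨haz.symm, hqc⟩)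
      (by rw [List.nodup_cons]; exact ⟨hz, hqn⟩)
    simp at this
  have hout : ∃ z, z ∉ q ∨ 3 ≤ q.length := by
    by_contra! h
    have h1 : Fintype.card V ≤ q.toFinset.card := by
      rw [← Finset.card_univ]
      exact Finset.card_le_card fun x _ => List.mem_toFinset.mpr (h x).1
    have := List.toFinset_card_le q
    have := (h a₀).2
    omega
  match q, hqc, hqn, hmax, hclosed, hout with
  | [], _, _, hmax, _, _ =>
    have := hmax [a₀] (List.isChain_singleton _) (by simp)
    simp at this
  | [a], hqc, _, _, hclosed, ⟨z, hz⟩ =>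
    obtain ⟨u, hu, v, -, hv, -, huv⟩ := exists_adj_of_connected_induce (T := {x | x ∈ [a]})
      (connected_induce_univ hG) (a := a) (by simp) trivial (x := z) trivial
        (by simpa using hz)
    obtain rfl : u = a := by simpa using hu
    exact absurd (hclosed u [] rfl v huv) hv
  | [a, b], hqc, hqn, hmax, hclosed, ⟨z, hz⟩ =>
    obtain ⟨u, hu, v, -, hv, -, huv⟩ := exists_adj_of_connected_induce (T := {x | x ∈ [a, b]})
      (connected_induce_univ hG) (a := a) (by simp) trivial (x := z) trivial
        (by simpa using hz)
    have hab : G.Adj a b := by simpa using hqc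
    simp only [Set.mem_ofPred_eq, List.mem_cons, List.not_mem_nil, or_false] at hu hv
    push Not at hv
    exfalso
    rcases hu with rfl | rfl
    · have := hclosed u [b] rfl v huv
      simp [hv] at this
    · have := hmax [v, u, a] (by simp [huv.symm, hab.symm]) (by simp [hv, hab.ne'])
      simp at this
  | a :: b :: c :: l, hqc, hqn, hmax, _, _ =>
    obtain ⟨l', x, hl'⟩ : ∃ l' x, c :: l = l' ++ [x] :=
      ⟨(c :: l).dropLast, (c :: l).getLast (by simp), (List.dropLast_append_getLast _).symm⟩
    rw [hl'] at hqc hqn hmax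
    exact ⟨a, b, x, l', hqc, hqn, hmax⟩

/-- If the number of leaves is bounded, there is a long path. -/
theorem exists_long_path [Fintype V] (hG : G.Connected) {c : ℕ}
    (hcard : 2 * c ^ 2 + 2 ≤ Fintype.card V + c)
    (hleaf : ∀ S L, LeafInv G S L → L.card + 2 ≤ c) :
    ∃ q : List V, List.IsChain G.Adj q ∧ q.Nodup ∧ 4 * c + 6 ≤ q.length := by
  classical
  have hV : 3 ≤ Fintype.card V := by
    obtain ⟨a⟩ := hG.nonempty
    have := hleaf _ _ (LeafInv.singleton a)
    nlinarith
  obtain ⟨a, b, x, l, hc, hn, hmax⟩ := exists_longest_path hG hV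
  refine ⟨_, hc, hn, ?_⟩
  have hI := LeafInv.of_longest_path hc hn hmax
  set q := a :: b :: (l ++ [x]) with hq
  by_contra! hlt
  -- Invariant: each explored vertex starts an explored path on at least `(|q| + 1) / 2` vertices. A
  -- new search path, read backwards and continued by such a path, is no longer than `q`. Hence it
  -- adds at most `(|q| - 1) / 2` vertices.
  have key : ∀ k (S L : Finset V), Fintype.card V - S.card = k → S.Nonempty → LeafInv G S L →
      2 ≤ L.card → (∀ h ∈ S, ∃ q', List.IsChain G.Adj (h :: q') ∧ (h :: q').Nodup ∧
        (∀ y ∈ h :: q', y ∈ S) ∧ q.length + 1 ≤ 2 * (h :: q').length) →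
      2 * S.card ≤ 2 * q.length + (L.card - 2) * (q.length - 1) → False := by
    intro k
    induction k using Nat.strong_induction_on with
    | _ k ih =>
    intro S L hk hne hI hL hpath hcost
    by_cases hall : ∀ x, x ∈ S
    · have hS : S.card = Fintype.card V := by
        rw [Finset.eq_univ_iff_forall.mpr hall, Finset.card_univ]
      have hLc := hleaf S L hI
      -- From `|q| ≤ 4 * c + 5` and `|L| ≤ c - 2` follows `2 * |V| ≤ 2 * (4 * c + 5) + (c - 4) * (4
      -- * c + 4)`, which is too small.
      obtain ⟨m, rfl⟩ : ∃ m, c = m + 4 := ⟨c - 4, by omega⟩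
      have h1 : (L.card - 2) * (q.length - 1) ≤ m * (4 * m + 20) :=
        Nat.mul_le_mul (by omega) (by omega)
      nlinarith
    push Not at hall
    obtain ⟨h, hh, l', y, hc', hn', hd', hm'⟩ := exists_maximal_path hG hne hall
    obtain ⟨q', hq1, hq2, hq3, hq4⟩ := hpath h hh
    have hdisj : ∀ u, u ∈ l' ++ [y] → u ∉ h :: q' := fun u hu hu' => hd' u hu (hq3 u hu')
    -- From a vertex `u` of the new path `s`, go back along `s` to its origin `g` and continue along
    -- `p`. Every `u` inherits the invariant, and the last one gives a path through all of `s`.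
    have hback : ∀ (s : List V) (g : V) (p : List V), List.IsChain G.Adj (g :: p) →
        (g :: p).Nodup → List.IsChain G.Adj (g :: s) → s.Nodup → (∀ u ∈ s, u ∉ g :: p) →
        ∀ u ∈ s, ∃ p', List.IsChain G.Adj (u :: p') ∧ (u :: p').Nodup ∧
          (∀ w ∈ u :: p', w ∈ s ∨ w ∈ g :: p) ∧ (g :: p).length ≤ (u :: p').length ∧
          (∀ s', s = s' ++ [u] → (u :: p').length = s.length + (g :: p).length) := by
      intro s
      induction s with
      | nil => simp
      | cons a s ihs =>
        intro g p h1 h2 h3 h4 h5 u hu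
        rw [List.isChain_cons_cons] at h3
        rw [List.nodup_cons] at h4
        have h6 : List.IsChain G.Adj (a :: g :: p) := by
          rw [List.isChain_cons_cons]; exact ⟨h3.1.symm, h1⟩
        have h7 : (a :: g :: p).Nodup := by
          rw [List.nodup_cons]; exact ⟨h5 a (by simp), h2⟩
        by_cases hus : u ∈ s
        · obtain ⟨p', g1, g2, g3, g4, g5⟩ := ihs a (g :: p) h6 h7 h3.2 h4.2 (by
            intro w hw hwm
            rcases List.mem_cons.mp hwm with rfl | hwm
            · exact h4.1 hw
            · exact h5 w (by simp [hw]) hwm) u hus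
          refine ⟨p', g1, g2, ?_, ?_, ?_⟩
          · intro w hw
            have := g3 w hw
            simp only [List.mem_cons] at this ⊢
            tauto
          · simp only [List.length_cons] at g4 ⊢; omega
          · intro s' hs'
            cases s' with
            | nil =>
              simp only [List.nil_append, List.cons.injEq] at hs'
              rw [hs'.2] at hus
              simp at hus
            | cons e s' =>
              simp only [List.cons_append, List.cons.injEq] at hs'
              have := g5 s' hs'.2
              simp only [List.length_cons] at this ⊢
              omega
        · obtain rfl : u = a := by
            rcases List.mem_cons.mp hu with h | h
            · exact h
            · exact absurd h hus
          refine ⟨g :: p, h6, h7, ?_, by simp, ?_⟩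
          · intro w hw
            simp only [List.mem_cons] at hw ⊢
            tauto
          · intro s' hs'
            cases s' with
            | nil =>
              simp only [List.nil_append, List.cons.injEq] at hs'
              simp [hs'.2]; omega
            | cons e s' =>
              simp only [List.cons_append, List.cons.injEq] at hs'
              rw [hs'.2] at hus
              simp at hus
    have hlen : 2 * (l' ++ [y]).length + 1 ≤ q.length := by
      obtain ⟨p', g1, g2, -, -, g5⟩ := hback _ h q' hq1 hq2 hc' hn' hdisj y (by simp)
      have := g5 l' rfl
      have := hmax _ g1 g2
      omega
    have hfd : Disjoint S (l' ++ [y]).toFinset := by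
      rw [Finset.disjoint_right]
      intro u hu
      exact hd' u (List.mem_toFinset.mp hu)
    have hScard : (S ∪ (l' ++ [y]).toFinset).card = S.card + (l' ++ [y]).length := by
      rw [Finset.card_union_of_disjoint hfd, List.toFinset_card_of_nodup hn']
    have hyL : y ∉ L := fun hx => hd' y (by simp) (hI.sub hx)
    have hLcard : (insert y L).card = L.card + 1 := Finset.card_insert_of_notMem hyL
    have hle := Finset.card_le_univ (S ∪ (l' ++ [y]).toFinset)
    have hpos : 0 < (l' ++ [y]).length := by simp
    refine ih _ ?_ _ _ rfl (hne.mono Finset.subset_union_left) (hI.extend hh hc' hn' hd' hm') ?_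
      ?_ ?_
    · omega
    · omega
    · intro u hu
      rcases Finset.mem_union.mp hu with hu | hu
      · obtain ⟨p, h1, h2, h3, h4⟩ := hpath u hu
        exact ⟨p, h1, h2, fun w hw => Finset.mem_union_left _ (h3 w hw), h4⟩
      · obtain ⟨p', g1, g2, g3, g4, -⟩ := hback _ h q' hq1 hq2 hc' hn' hdisj u
          (List.mem_toFinset.mp hu)
        refine ⟨p', g1, g2, ?_, by omega⟩
        intro w hw
        rcases g3 w hw with hw | hw
        · exact Finset.mem_union_right _ (List.mem_toFinset.mpr hw)
        · exact Finset.mem_union_left _ (hq3 w hw)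
    · obtain ⟨m, hm⟩ : ∃ m, L.card = m + 2 := ⟨L.card - 2, by omega⟩
      have hmul : (m + 1) * (q.length - 1) = m * (q.length - 1) + (q.length - 1) := by ring
      have e1 : L.card + 1 - 2 = m + 1 := by omega
      have e2 : L.card - 2 = m := by omega
      rw [hScard, hLcard, e1, hmul]
      rw [e2] at hcost
      omega
  refine key _ _ _ rfl ⟨a, by simp [hq]⟩ hI ?_ ?_ ?_
  · rw [Finset.card_pair]
    rintro rfl
    simp [hq] at hn
  · intro h hh
    rw [List.mem_toFinset] at hh
    obtain ⟨l₁, l₂, hl⟩ := List.append_of_mem hh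
    -- From a vertex of `q` the longer direction along `q` contains at least half of it.
    by_cases hll : l₁.length ≤ l₂.length
    · refine ⟨l₂, ?_, ?_, ?_, ?_⟩
      · rw [hl] at hc; exact hc.right_of_append
      · rw [hl] at hn; exact hn.of_append_right
      · intro y hy
        rw [List.mem_toFinset, hl]
        exact List.mem_append_right _ hy
      · rw [hl]
        simp only [List.length_append, List.length_cons]
        omega
    · have hrev : q.reverse = l₂.reverse ++ (h :: l₁.reverse) := by simp [hl]
      refine ⟨l₁.reverse, ?_, ?_, ?_, ?_⟩
      · have : List.IsChain G.Adj q.reverse := by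
          rw [List.isChain_reverse]
          exact hc.imp fun _ _ h => h.symm
        rw [hrev] at this
        exact this.right_of_append
      · have : q.reverse.Nodup := List.nodup_reverse.mpr hn
        rw [hrev] at this
        exact this.of_append_right
      · intro y hy
        rw [List.mem_toFinset, ← List.mem_reverse, hrev]
        exact List.mem_append_right _ hy
      · rw [hl]
        simp only [List.length_append, List.length_cons, List.length_reverse]
        omega
  · rw [List.toFinset_card_of_nodup hn]
    omega

end LongPath

/-! ### Paths in graphs without balance -/

section Shape

variable {V : Type*} {G : SimpleGraph V}

theorem cycleGraph_adj_iff {k : ℕ} (hk : 2 ≤ k) {i j : Fin k} :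
    (SimpleGraph.cycleGraph k).Adj i j ↔
      ((i : ℕ) = j + 1 ∨ (i : ℕ) = 0 ∧ (j : ℕ) + 1 = k) ∨
        ((j : ℕ) = i + 1 ∨ (j : ℕ) = 0 ∧ (i : ℕ) + 1 = k) := by
  have hmod : ∀ x y : ℕ, x < k → y < k →
      ((k - y + x) % k = 1 ↔ x = y + 1 ∨ (x = 0 ∧ y + 1 = k)) := by
    intro x y hx hy
    by_cases hxy : y ≤ x
    · rw [show k - y + x = k + (x - y) by omega, Nat.add_mod_left, Nat.mod_eq_of_lt (by omega)]
      omega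
    · rw [Nat.mod_eq_of_lt (by omega)]
      omega
  rw [SimpleGraph.cycleGraph_adj', Fin.val_sub, Fin.val_sub, hmod i j i.2 j.2, hmod j i j.2 i.2]

/-- The first `k` values of `d` form a path. -/
structure IsPathSeq (G : SimpleGraph V) (k : ℕ) (d : ℕ → V) : Prop where
  inj : ∀ i < k, ∀ j < k, d i = d j → i = j
  adj : ∀ i, i + 1 < k → G.Adj (d i) (d (i + 1))

theorem IsPathSeq.reverse {k : ℕ} {d : ℕ → V} (h : IsPathSeq G k d) :
    IsPathSeq G k fun i => d (k - 1 - i) := by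
  refine ⟨fun i hi j hj hij => ?_, fun i hi => ?_⟩
  · have := h.inj _ (by omega) _ (by omega) hij
    omega
  · have := h.adj (k - 1 - (i + 1)) (by omega)
    rw [show k - 1 - (i + 1) + 1 = k - 1 - i by omega] at this
    exact this.symm

theorem IsPathSeq.connected {k : ℕ} {d : ℕ → V} (h : IsPathSeq G k d) {a b : ℕ} (hab : a ≤ b)
    (hb : b < k) : (G.induce {x | ∃ i, a ≤ i ∧ i ≤ b ∧ x = d i}).Connected := by
  obtain ⟨m, rfl⟩ := Nat.exists_eq_add_of_le hab
  clear hab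
  induction m with
  | zero =>
    refine Connected.induce_congr (connected_induce_singleton (d a)) ?_
    ext x
    constructor
    · rintro rfl
      exact ⟨a, le_rfl, le_rfl, rfl⟩
    · rintro ⟨i, h1, h2, rfl⟩
      rw [show i = a by omega]
      rfl
  | succ m ih =>
    refine Connected.induce_congr (connected_induce_insert (ih (by omega))
      ⟨a + m, by omega, le_rfl, rfl⟩ (h.adj (a + m) (by omega))) ?_
    ext x
    constructor
    · rintro (rfl | ⟨i, h1, h2, rfl⟩)
      · exact ⟨a + m + 1, by omega, by omega, rfl⟩
      · exact ⟨i, by omega, by omega, rfl⟩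
    · rintro ⟨i, h1, h2, rfl⟩
      by_cases hi : i = a + m + 1
      · exact Or.inl (by rw [hi])
      · exact Or.inr ⟨i, h1, by omega, rfl⟩

theorem IsPathSeq.ncard {k : ℕ} {d : ℕ → V} (h : IsPathSeq G k d) {a b : ℕ} (hb : b < k) :
    {x | ∃ i, a ≤ i ∧ i ≤ b ∧ x = d i}.ncard = b + 1 - a := by
  have : {x | ∃ i, a ≤ i ∧ i ≤ b ∧ x = d i} = d '' (Finset.Icc a b : Set ℕ) := by
    ext x
    simp only [Set.mem_ofPred_eq, Finset.coe_Icc, Set.mem_image, Set.mem_Icc]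
    constructor
    · rintro ⟨i, h1, h2, rfl⟩; exact ⟨i, ⟨h1, h2⟩, rfl⟩
    · rintro ⟨i, ⟨h1, h2⟩, rfl⟩; exact ⟨i, h1, h2, rfl⟩
  rw [this, Set.InjOn.ncard_image, Set.ncard_coe_finset, Nat.card_Icc]
  intro i hi j hj hij
  simp only [Finset.coe_Icc, Set.mem_Icc] at hi hj
  exact h.inj i (by omega) j (by omega) hij

theorem IsPathSeq.notMem {k : ℕ} {d : ℕ → V} (h : IsPathSeq G k d) {a b j : ℕ} (hb : b < k)
    (hj : j < k) (hjab : j < a ∨ b < j) : d j ∉ {x | ∃ i, a ≤ i ∧ i ≤ b ∧ x = d i} := by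
  rintro ⟨i, h1, h2, h3⟩
  have := h.inj j hj i (by omega) h3
  omega

/-- A vertex in the middle of a path, far from its ends and with a neighbour that is not one of its
neighbours on the path nor an earlier vertex of the path, gives balance. -/
theorem IsPathSeq.hasBalance {k t : ℕ} {d : ℕ → V} (h : IsPathSeq G k d) {i : ℕ} {x : V}
    (ht : 0 < t) (hi : t ≤ i) (hik : i + t + 2 ≤ k) (hx : G.Adj (d i) x)
    (hxd : ∀ j, j ≤ i + 1 → x ≠ d j) : HasBalance G t := by
  have hA : (G.induce (insert (d i) {x | ∃ j, 0 ≤ j ∧ j ≤ i - 1 ∧ x = d j})).Connected := by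
    refine connected_induce_insert (h.connected (Nat.zero_le _) (by omega))
      ⟨i - 1, by omega, le_rfl, rfl⟩ ?_
    have := h.adj (i - 1) (by omega)
    rwa [Nat.sub_add_cancel (by omega)] at this
  by_cases hxk : ∃ j < k, x = d j
  -- The edge to `x` is a chord: `d (i + 1)` plays the part of `y`, and the later vertices of the
  -- path are attached to `d i` through the chord.
  · obtain ⟨j, hj, rfl⟩ := hxk
    have hji : i + 1 < j := by
      by_contra hcon
      exact hxd j (by omega) rfl
    have hB : (G.induce (insert (d i) {x | ∃ j, i + 2 ≤ j ∧ j ≤ k - 1 ∧ x = d j})).Connected :=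
      connected_induce_insert (h.connected (by omega) (by omega)) ⟨j, by omega, by omega, rfl⟩
        hx.symm
    refine ⟨d i, d (i + 1), _, _, h.adj i (by omega), h.notMem (by omega) (by omega) (by omega),
      h.notMem (by omega) (by omega) (by omega), h.notMem (by omega) (by omega) (by omega),
      h.notMem (by omega) (by omega) (by omega), ?_, hA, hB, ?_, ?_⟩
    · rw [Set.disjoint_left]
      rintro _ ⟨j, -, hj, rfl⟩
      exact h.notMem (by omega) (by omega) (by omega)
    · rw [h.ncard (by omega)]; omega
    · rw [h.ncard (by omega)]; omega
  -- Here `x` is off the path and is itself the vertex `y`.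
  · push Not at hxk
    have hB : (G.induce (insert (d i) {x | ∃ j, i + 1 ≤ j ∧ j ≤ k - 1 ∧ x = d j})).Connected :=
      connected_induce_insert (h.connected (by omega) (by omega))
        ⟨i + 1, by omega, by omega, rfl⟩ (h.adj i (by omega)).symm
    refine ⟨d i, x, _, _, hx, h.notMem (by omega) (by omega) (by omega),
      h.notMem (by omega) (by omega) (by omega), ?_, ?_, ?_, hA, hB, ?_, ?_⟩
    · rintro ⟨j, -, hj, rfl⟩
      exact hxk j (by omega) rfl
    · rintro ⟨j, -, hj, rfl⟩
      exact hxk j (by omega) rfl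
    · rw [Set.disjoint_left]
      rintro _ ⟨j, -, hj, rfl⟩
      exact h.notMem (by omega) (by omega) (by omega)
    · rw [h.ncard (by omega)]; omega
    · rw [h.ncard (by omega)]; omega

theorem IsPathSeq.neighborSet_eq {k t : ℕ} {d : ℕ → V} (h : IsPathSeq G k d)
    (hbal : ¬ HasBalance G t) {i : ℕ} (ht : 0 < t) (hi : t + 1 ≤ i) (hik : i + t + 2 ≤ k) :
    G.neighborSet (d i) = {d (i - 1), d (i + 1)} := by
  have h1 : G.Adj (d i) (d (i - 1)) := by
    have := h.adj (i - 1) (by omega)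
    rw [Nat.sub_add_cancel (by omega)] at this
    exact this.symm
  ext x
  simp only [SimpleGraph.mem_neighborSet, Set.mem_insert_iff, Set.mem_singleton_iff]
  constructor
  · intro hx
    by_contra! hne
    by_cases hlow : ∃ j < i, x = d j
    · obtain ⟨j, hj, rfl⟩ := hlow
      have hr := h.reverse
      -- A backward chord is a forward one on the reversed path. This is why `i` has to exceed `t`
      -- and not merely reach it.
      refine hbal (hr.hasBalance (i := k - 1 - i) (x := d j) ht (by omega) (by omega) ?_ ?_)
      · rwa [show k - 1 - (k - 1 - i) = i by omega]
      · intro m hm hjm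
        have := h.inj j (by omega) (k - 1 - m) (by omega) hjm
        have : j = i - 1 := by omega
        exact hne.1 (by rw [this])
    · push Not at hlow
      refine hbal (h.hasBalance ht (by omega) hik hx fun j hj => ?_)
      rcases lt_trichotomy j i with hji | rfl | hji
      · exact hlow j hji
      · exact hx.ne'
      · rw [show j = i + 1 by omega]
        exact hne.2
  · rintro (rfl | rfl)
    · exact h1
    · exact h.adj i (by omega)

/-! ### Threads and what is attached to their ends -/

/-- A path all of whose vertices have degree two in the whole graph. -/
structure IsThread (G : SimpleGraph V) (k : ℕ) (d : ℕ → V) : Prop extends IsPathSeq G k d where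
  degree : ∀ i < k, (G.neighborSet (d i)).ncard = 2

theorem IsThread.reverse {k : ℕ} {d : ℕ → V} (h : IsThread G k d) :
    IsThread G k fun i => d (k - 1 - i) :=
  ⟨h.toIsPathSeq.reverse, fun i hi => h.degree _ (by omega)⟩

theorem exists_isThread [Fintype V] {c : ℕ} {q : List V} (hq : List.IsChain G.Adj q)
    (hn : q.Nodup) (hlen : 4 * c + 6 ≤ q.length) (hbal : ¬ HasBalance G (c + 1)) :
    ∃ d, IsThread G (2 * c + 2) d := by
  obtain ⟨a, ha⟩ : ∃ a, a ∈ q := List.exists_mem_of_length_pos (by omega)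
  have hP : IsPathSeq G q.length fun i => q.getD i a := by
    refine ⟨fun i hi j hj hij => ?_, fun i hi => ?_⟩
    · simp only [List.getD_eq_getElem _ _ hi, List.getD_eq_getElem _ _ hj] at hij
      exact (hn.getElem_inj_iff).mp hij
    · rw [List.getD_eq_getElem _ _ (by omega), List.getD_eq_getElem _ _ hi]
      exact List.isChain_iff_getElem.mp hq i hi
  -- With `t = c + 1`, dropping `c + 2` vertices at each end of the path leaves `2 * c + 2` vertices
  -- of degree two.
  refine ⟨fun i => q.getD (c + 2 + i) a, ⟨fun i hi j hj hij => ?_, fun i hi => ?_⟩, fun i hi => ?_⟩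
  · have := hP.inj _ (by omega) _ (by omega) hij
    omega
  · exact hP.adj (c + 2 + i) (by omega)
  · have := hP.neighborSet_eq hbal (i := c + 2 + i) (by omega) (by omega) (by omega)
    rw [this, Set.ncard_pair]
    intro hcon
    have := hP.inj _ (by omega) _ (by omega) hcon
    omega

theorem eq_pair_of_ncard {s : Set V} (hs : s.ncard = 2) {u v : V} (hu : u ∈ s) (hv : v ∈ s)
    (huv : u ≠ v) : s = {u, v} := by
  symm
  refine Set.eq_of_subset_of_ncard_le ?_ ?_ (Set.finite_of_ncard_ne_zero (by omega))
  · rintro x (rfl | rfl) <;> assumption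
  · rw [hs, Set.ncard_pair huv]

/-- The vertices next to the two ends of a thread. -/
structure ThreadEnds (G : SimpleGraph V) (k : ℕ) (d : ℕ → V) (a b : V) : Prop
    extends IsThread G k d where
  three_le : 3 ≤ k
  nbr_zero : G.neighborSet (d 0) = {d 1, a}
  nbr_last : G.neighborSet (d (k - 1)) = {d (k - 2), b}
  a_ne : a ≠ d 1
  b_ne : b ≠ d (k - 2)

theorem IsThread.exists_ends {k : ℕ} {d : ℕ → V} (h : IsThread G k d) (hk : 3 ≤ k) :
    ∃ a b, ThreadEnds G k d a b := by
  have key : ∀ i < k, ∀ j < k, G.Adj (d i) (d j) →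
      ∃ a, G.neighborSet (d i) = {d j, a} ∧ a ≠ d j := by
    intro i hi j hj hij
    obtain ⟨x, y, hxy, hs⟩ := Set.ncard_eq_two.mp (h.degree i hi)
    have hmem : d j ∈ G.neighborSet (d i) := hij
    rw [hs] at hmem
    rcases hmem with hm | hm
    · exact ⟨y, by rw [hs, hm], by rw [hm]; exact hxy.symm⟩
    · rw [Set.mem_singleton_iff] at hm
      exact ⟨x, by rw [hs, hm, Set.pair_comm], by rw [hm]; exact hxy⟩
  obtain ⟨a, ha, ha'⟩ := key 0 (by omega) 1 (by omega) (h.adj 0 (by omega))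
  obtain ⟨b, hb, hb'⟩ := key (k - 1) (by omega) (k - 2) (by omega) (by
    have := h.adj (k - 2) (by omega)
    rw [show k - 2 + 1 = k - 1 by omega] at this
    exact this.symm)
  exact ⟨a, b, h, hk, ha, hb, ha', hb'⟩

namespace ThreadEnds

variable {k : ℕ} {d : ℕ → V} {a b : V}

theorem reverse (h : ThreadEnds G k d a b) : ThreadEnds G k (fun i => d (k - 1 - i)) b a := by
  have hk := h.three_le
  refine ⟨h.toIsThread.reverse, hk, ?_, ?_, ?_, ?_⟩
  · simpa [show k - 1 - 1 = k - 2 by omega] using h.nbr_last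
  · simpa [show k - 1 - (k - 2) = 1 by omega] using h.nbr_zero
  · simpa [show k - 1 - 1 = k - 2 by omega] using h.b_ne
  · simpa [show k - 1 - (k - 2) = 1 by omega] using h.a_ne

theorem adj_a (h : ThreadEnds G k d a b) : G.Adj (d 0) a := by
  have : a ∈ G.neighborSet (d 0) := by rw [h.nbr_zero]; exact Or.inr rfl
  exact this

theorem adj_b (h : ThreadEnds G k d a b) : G.Adj (d (k - 1)) b := by
  have : b ∈ G.neighborSet (d (k - 1)) := by rw [h.nbr_last]; exact Or.inr rfl
  exact this

theorem nbr_mid (h : ThreadEnds G k d a b) {i : ℕ} (hi : 0 < i) (hik : i + 1 < k) :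
    G.neighborSet (d i) = {d (i - 1), d (i + 1)} := by
  have h1 := h.adj (i - 1) (by omega)
  rw [Nat.sub_add_cancel hi] at h1
  refine eq_pair_of_ncard (h.degree i (by omega)) h1.symm (h.adj i hik) ?_
  intro hcon
  have := h.inj _ (by omega) _ (by omega) hcon
  omega

/-- The neighbours of the vertices of a thread. -/
theorem adj_cases (h : ThreadEnds G k d a b) {i : ℕ} (hi : i < k) {x : V} (hx : G.Adj (d i) x) :
    (0 < i ∧ x = d (i - 1)) ∨ (i + 1 < k ∧ x = d (i + 1)) ∨ (i = 0 ∧ x = a) ∨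
      (i + 1 = k ∧ x = b) := by
  have hk := h.three_le
  have hx' : x ∈ G.neighborSet (d i) := hx
  by_cases h0 : i = 0
  · subst h0
    rw [h.nbr_zero] at hx'
    rcases hx' with hx' | hx'
    · exact Or.inr (Or.inl ⟨by omega, hx'⟩)
    · exact Or.inr (Or.inr (Or.inl ⟨rfl, hx'⟩))
  by_cases h1 : i + 1 = k
  · obtain rfl : i = k - 1 := by omega
    rw [h.nbr_last] at hx'
    rcases hx' with hx' | hx'
    · exact Or.inl ⟨by omega, hx'⟩
    · exact Or.inr (Or.inr (Or.inr ⟨h1, hx'⟩))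
  · rw [h.nbr_mid (by omega) (by omega)] at hx'
    rcases hx' with hx' | hx'
    · exact Or.inl ⟨by omega, hx'⟩
    · exact Or.inr (Or.inl ⟨by omega, hx'⟩)

/-- Vertices strictly inside the thread already have both their neighbours on it, next to them. So
an end can only be adjacent to its successor or to the other end. -/
theorem closed (h : ThreadEnds G k d a b) (ha : ∃ i < k, a = d i) : a = d (k - 1) ∧ b = d 0 := by
  obtain ⟨i, hi, rfl⟩ := ha
  have h0 := h.adj_a.symm
  have hi0 : i ≠ 0 := fun h0' => h.adj_a.ne (by rw [h0'])
  have hi1 : i ≠ 1 := fun h1' => h.a_ne (by rw [h1'])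
  rcases h.adj_cases hi h0 with ⟨-, h2⟩ | ⟨h1, h2⟩ | ⟨h1, -⟩ | ⟨h1, h2⟩
  · have := h.inj _ (by omega) _ (by omega) h2
    omega
  · have := h.inj _ (by omega) _ (by omega) h2
    omega
  · exact absurd h1 hi0
  · rw [show i = k - 1 by omega]
    exact ⟨rfl, h2.symm⟩

/-- A thread whose ends are adjacent is a whole component. -/
theorem nonempty_iso (h : ThreadEnds G k d a b) (hG : G.Connected) (ha : ∃ i < k, a = d i) :
    Nonempty (G ≃g SimpleGraph.cycleGraph k) := by
  have hk := h.three_le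
  obtain ⟨rfl, rfl⟩ := h.closed ha
  have hall : ∀ x, ∃ i < k, d i = x := by
    intro x
    by_contra hx
    obtain ⟨u, ⟨i, hi, rfl⟩, v, -, hv, -, huv⟩ := exists_adj_of_connected_induce
      (T := {x | ∃ i < k, d i = x}) (connected_induce_univ hG) (a := d 0) ⟨0, by omega, rfl⟩ trivial
      (x := x) trivial hx
    apply hv
    rcases h.adj_cases hi huv with ⟨h1, rfl⟩ | ⟨h1, rfl⟩ | ⟨h1, rfl⟩ | ⟨h1, rfl⟩
    · exact ⟨_, by omega, rfl⟩
    · exact ⟨_, by omega, rfl⟩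
    · exact ⟨_, by omega, rfl⟩
    · exact ⟨_, by omega, rfl⟩
  let f : Fin k → V := fun i => d i
  have hf : Function.Bijective f := by
    refine ⟨fun i j hij => Fin.ext (h.inj i i.2 j j.2 hij), fun x => ?_⟩
    obtain ⟨i, hi, hx⟩ := hall x
    exact ⟨⟨i, hi⟩, hx⟩
  refine ⟨(⟨Equiv.ofBijective f hf, ?_⟩ : SimpleGraph.cycleGraph k ≃g G).symm⟩
  intro i j
  rw [cycleGraph_adj_iff (by omega)]
  show G.Adj (d i) (d j) ↔ _
  have hi := i.2
  constructor
  · intro hadj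
    rcases h.adj_cases hi hadj with ⟨h1, h2⟩ | ⟨h1, h2⟩ | ⟨h1, h2⟩ | ⟨h1, h2⟩ <;>
    · have := h.inj _ (by omega) _ (by omega) h2
      omega
  · rintro ((h1 | ⟨h1, h2⟩) | (h1 | ⟨h1, h2⟩))
    · rw [h1]
      exact (h.adj j (by omega)).symm
    · have := h.adj_a
      rwa [h1, show (j : ℕ) = k - 1 by omega]
    · rw [h1]
      exact h.adj i (by omega)
    · have := h.adj_b
      rwa [h1, show (i : ℕ) = k - 1 by omega]

theorem b_notMem (h : ThreadEnds G k d a b) (ha : ∀ i < k, a ≠ d i) : ∀ i < k, b ≠ d i := by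
  intro i hi hb
  have := (h.reverse.closed ⟨k - 1 - i, by omega, by
    rwa [show k - 1 - (k - 1 - i) = i by omega]⟩).2
  exact ha _ (by omega) this

/-- The first vertex outside a longest thread does not have degree two. -/
theorem degree_ne (h : ThreadEnds G k d a b) (hmax : ∀ d', ¬ IsThread G (k + 1) d')
    (ha : ∀ i < k, a ≠ d i) : (G.neighborSet a).ncard ≠ 2 := by
  intro hdeg
  refine hmax (fun i => if i = 0 then a else d (i - 1)) ⟨⟨?_, ?_⟩, ?_⟩
  · intro i hi j hj hij
    by_cases hi0 : i = 0 <;> by_cases hj0 : j = 0 <;> simp only [hi0, hj0, if_true, if_false] at hij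
    · omega
    · exact absurd hij (ha _ (by omega))
    · exact absurd hij.symm (ha _ (by omega))
    · have := h.inj _ (by omega) _ (by omega) hij
      omega
  · intro i hi
    by_cases hi0 : i = 0
    · simpa [hi0] using h.adj_a.symm
    · simp only [hi0, if_false, Nat.add_eq_zero_iff, one_ne_zero, and_false, Nat.add_sub_cancel]
      have := h.adj (i - 1) (by omega)
      rwa [Nat.sub_add_cancel (by omega)] at this
  · intro i hi
    by_cases hi0 : i = 0
    · simpa [hi0] using hdeg
    · simp only [hi0, if_false]
      exact h.degree _ (by omega)

/-- The vertices that are not on the thread. -/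
def rest (k : ℕ) (d : ℕ → V) : Set V := {x | ∀ i < k, x ≠ d i}

theorem rest_reverse : rest k (fun i => d (k - 1 - i)) = rest k d := by
  ext x
  constructor
  · intro h i hi
    have : x ≠ d (k - 1 - (k - 1 - i)) := h (k - 1 - i) (by omega)
    rwa [show k - 1 - (k - 1 - i) = i by omega] at this
  · intro h i hi
    exact h _ (by omega)

end ThreadEnds

/-- On a walk from `a`, start afresh from `a` at the last visit to `y₁` or `y₂`. The shortened walk
meets at most one of the two. -/
theorem reachIn_subset_union {Z : Set V} {a y₁ y₂ : V} (h1 : G.Adj a y₁) (h2 : G.Adj a y₂)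
    (hne : y₁ ≠ y₂) :
    reachIn G Z a ⊆ reachIn G (Z \ {y₁}) a ∪ reachIn G (Z \ {y₂}) a := by
  intro x hx
  induction hx with
  | refl => exact Or.inl (self_mem_reachIn _ _)
  | @tail u v _ huv ih =>
    by_cases hv1 : v = y₁
    · exact Or.inr (mem_reachIn_of_adj (self_mem_reachIn _ _) (hv1 ▸ h1)
        ⟨huv.2, fun h => hne (hv1.symm.trans h)⟩)
    by_cases hv2 : v = y₂
    · exact Or.inl (mem_reachIn_of_adj (self_mem_reachIn _ _) (hv2 ▸ h2)
        ⟨huv.2, fun h => hne (h.symm.trans hv2)⟩)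
    rcases ih with ih | ih
    · exact Or.inl (mem_reachIn_of_adj ih huv.1 ⟨huv.2, hv1⟩)
    · exact Or.inr (mem_reachIn_of_adj ih huv.1 ⟨huv.2, hv2⟩)

theorem notMem_reachIn_sdiff {Z : Set V} {a y : V} (h : a ≠ y) :
    y ∉ reachIn G (Z \ {y}) a := by
  intro hy
  rcases reachIn_subset hy with h' | h'
  · exact h h'.symm
  · exact h'.2 rfl

theorem ncard_ne_two_cases [Finite V] {a u : V} (h : (G.neighborSet a).ncard ≠ 2)
    (hu : G.Adj a u) {v : V} (hv : G.Adj a v) (huv : u ≠ v) :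
    ∃ w, G.Adj a w ∧ w ≠ u ∧ w ≠ v := by
  by_contra! hcon
  apply h
  have : G.neighborSet a = {u, v} := by
    ext x
    constructor
    · intro hx
      by_cases hxu : x = u
      · exact Or.inl hxu
      · exact Or.inr (hcon x hx hxu)
    · rintro (rfl | rfl) <;> assumption
  rw [this, Set.ncard_pair huv]

namespace ThreadEnds

variable {k : ℕ} {d : ℕ → V} {a b : V}

/-- If the ends of a long thread are joined outside of it, there is balance. -/
theorem hasBalance_of_joined [Finite V] {t : ℕ} (h : ThreadEnds G k d a b) (ht : 0 < t)
    (hk : 2 * t ≤ k) (ha : a ∈ rest k d) (hdeg : (G.neighborSet a).ncard ≠ 2)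
    (hb : b ∈ reachIn G (rest k d) a) : HasBalance G t := by
  -- Balance at `a`: one branch is the initial part of the thread. The other goes through `R` to `b`
  -- and back along the final part of the thread. The vertex `y` is a spare neighbour outside both.
  have main : ∀ y R, G.Adj a y → y ∈ rest k d → y ∉ R → R ⊆ rest k d → a ∈ R → b ∈ R →
      (G.induce R).Connected → HasBalance G t := by
    intro y R hay hy hyR hR haR hbR hconn
    have hA : (G.induce (insert a {x | ∃ i, 0 ≤ i ∧ i ≤ t - 1 ∧ x = d i})).Connected :=
      connected_induce_insert (h.connected (Nat.zero_le _) (by omega))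
        ⟨0, le_rfl, by omega, rfl⟩ h.adj_a
    have hB : (G.induce (insert a (R \ {a} ∪ {x | ∃ i, t ≤ i ∧ i ≤ k - 1 ∧ x = d i}))).Connected := by
      refine Connected.induce_congr (SimpleGraph.connected_induce_union hconn.preconnected
        (h.connected (a := t) (b := k - 1) (by omega) (by omega)).preconnected hbR
        ⟨k - 1, by omega, le_rfl, rfl⟩ h.adj_b.symm) ?_
      ext x
      simp only [Set.mem_union, Set.mem_insert_iff, Set.mem_sdiff, Set.mem_singleton_iff]
      by_cases hxa : x = a
      · simp [hxa, haR]
      · simp [hxa]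
    refine ⟨a, y, _, _, hay, ?_, ?_, ?_, ?_, ?_, hA, hB, ?_, ?_⟩
    · rintro ⟨i, -, hi, hai⟩
      exact ha i (by omega) hai
    · rintro (⟨-, h2⟩ | ⟨i, -, hi, hai⟩)
      · exact h2 rfl
      · exact ha i (by omega) hai
    · rintro ⟨i, -, hi, hai⟩
      exact hy i (by omega) hai
    · rintro (⟨h1, -⟩ | ⟨i, -, hi, hai⟩)
      · exact hyR h1
      · exact hy i (by omega) hai
    · rw [Set.disjoint_left]
      rintro _ ⟨i, -, hi, rfl⟩ (⟨h1, -⟩ | h1)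
      · exact hR h1 i (by omega) rfl
      · exact h.notMem (by omega) (by omega) (by omega) h1
    · rw [h.ncard (by omega)]; omega
    · refine le_trans ?_ (Set.ncard_le_ncard Set.subset_union_right (Set.toFinite _))
      rw [h.ncard (by omega)]; omega
  have hnbr : ∀ x, G.Adj a x → x ≠ d 0 → x ≠ d (k - 1) → x ∈ rest k d := by
    rintro x hax h0 h1 i hi rfl
    rcases h.adj_cases hi hax.symm with ⟨h2, h3⟩ | ⟨h2, h3⟩ | ⟨h2, h3⟩ | ⟨h2, h3⟩
    · exact ha _ (by omega) h3
    · exact ha _ (by omega) h3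
    · exact h0 (by rw [h2])
    · exact h1 (by rw [← h2, Nat.add_sub_cancel])
  have hd01 : d 0 ≠ d (k - 1) := by
    intro hcon
    have := h.inj _ (by omega) _ (by omega) hcon
    omega
  by_cases hab : a = b
  · subst hab
    -- Both ends of the thread are neighbours of `a`, so a degree other than two provides a third
    -- neighbour.
    obtain ⟨y, hy, hy0, hy1⟩ := ncard_ne_two_cases hdeg h.adj_a.symm h.adj_b.symm hd01
    exact main y {a} hy (hnbr y hy hy0 hy1) hy.ne' (by rintro _ rfl; exact ha) rfl rfl
      (connected_induce_singleton a)
  · have hlast : ∀ x, G.Adj a x → x ≠ d (k - 1) := by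
      rintro x hax rfl
      rcases h.adj_cases (by omega) hax.symm with ⟨h2, h3⟩ | ⟨h2, h3⟩ | ⟨h2, h3⟩ | ⟨h2, h3⟩
      · exact ha _ (by omega) h3
      · exact ha _ (by omega) h3
      · omega
      · exact hab h3
    obtain ⟨u, hu, y₁, hy1, hy1n, -, hadj⟩ := exists_adj_of_connected_induce (T := {a})
      (connected_reachIn (G := G) (rest k d) a) rfl (self_mem_reachIn _ _) hb (Ne.symm hab)
    obtain rfl : u = a := hu
    have hy1Z : y₁ ∈ rest k d := by
      rcases reachIn_subset hy1 with h' | h'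
      · exact absurd h' hy1n
      · exact h'
    obtain ⟨y₂, hy2, hy2d, hy21⟩ := ncard_ne_two_cases hdeg h.adj_a.symm hadj
      (fun hcon => hy1Z 0 (by omega) hcon.symm)
    have hy2Z := hnbr y₂ hy2 hy2d (hlast y₂ hy2)
    have hsub : ∀ y, reachIn G (rest k d \ {y}) u ⊆ rest k d := by
      intro y x hx
      rcases reachIn_subset hx with rfl | h'
      · exact ha
      · exact h'.1
    -- One of the two neighbours of `a` off the thread can be spared on the way to `b`.
    rcases reachIn_subset_union hadj hy2 hy21.symm hb with hb' | hb'
    · exact main y₁ _ hadj hy1Z (notMem_reachIn_sdiff hadj.ne) (hsub _) (self_mem_reachIn _ _) hb'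
        (connected_reachIn _ _)
    · exact main y₂ _ hy2 hy2Z (notMem_reachIn_sdiff hy2.ne) (hsub _) (self_mem_reachIn _ _) hb'
        (connected_reachIn _ _)

/-- If there is no balance, only few vertices are attached to an end of a long thread. -/
theorem ncard_reachIn_le [Finite V] {t : ℕ} (h : ThreadEnds G k d a b) (ht : 0 < t)
    (hk : t ≤ k) (ha : a ∈ rest k d) (hdeg : (G.neighborSet a).ncard ≠ 2)
    (hb : b ∉ reachIn G (rest k d) a) (hbal : ¬ HasBalance G t) :
    (reachIn G (rest k d) a).ncard ≤ 2 * t := by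
  by_contra! hbig
  have hlast : b ≠ a := fun hcon => hb (hcon ▸ self_mem_reachIn _ _)
  have hnbr : ∀ x, G.Adj a x → x ≠ d 0 → x ∈ rest k d := by
    rintro x hax h0 i hi rfl
    rcases h.adj_cases hi hax.symm with ⟨h2, h3⟩ | ⟨h2, h3⟩ | ⟨h2, h3⟩ | ⟨h2, h3⟩
    · exact ha _ (by omega) h3
    · exact ha _ (by omega) h3
    · exact h0 (by rw [h2])
    · exact hlast h3.symm
  obtain ⟨x, hx, hxa⟩ : ∃ x ∈ reachIn G (rest k d) a, x ≠ a := by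
    by_contra! hcon
    have := Set.ncard_le_ncard (s := reachIn G (rest k d) a) (t := {a}) hcon (Set.toFinite _)
    rw [Set.ncard_singleton] at this
    omega
  obtain ⟨u, hu, y₁, hy1, hy1n, -, hadj⟩ := exists_adj_of_connected_induce (T := {a})
    (connected_reachIn (G := G) (rest k d) a) rfl (self_mem_reachIn _ _) hx hxa
  obtain rfl : u = a := hu
  have hy1Z : y₁ ∈ rest k d := by
    rcases reachIn_subset hy1 with h' | h'
    · exact absurd h' hy1n
    · exact h'
  obtain ⟨y₂, hy2, hy2d, hy21⟩ := ncard_ne_two_cases hdeg h.adj_a.symm hadj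
    (fun hcon => hy1Z 0 (by omega) hcon.symm)
  have hy2Z := hnbr y₂ hy2 hy2d
  -- If much could be reached without `y`, that part and the thread itself would be the two branches
  -- at `u`. Two choices of `y` then cover the whole clump, hence the bound `2 * t`.
  have main : ∀ y, G.Adj u y → y ∈ rest k d →
      (reachIn G (rest k d \ {y}) u).ncard ≤ t := by
    intro y hy hyZ
    by_contra! hlarge
    set R := reachIn G (rest k d \ {y}) u with hR
    have hRZ : R ⊆ rest k d := by
      intro x hx
      rcases reachIn_subset hx with rfl | h'
      · exact ha
      · exact h'.1
    refine hbal ⟨u, y, R \ {u}, {x | ∃ i, 0 ≤ i ∧ i ≤ k - 1 ∧ x = d i}, hy, fun hu => hu.2 rfl,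
      ?_, fun hyR => notMem_reachIn_sdiff hy.ne hyR.1, ?_, ?_, ?_, ?_, ?_, ?_⟩
    · rintro ⟨i, -, hi, hai⟩
      exact ha i (by omega) hai
    · rintro ⟨i, -, hi, hai⟩
      exact hyZ i (by omega) hai
    · rw [Set.disjoint_left]
      rintro x ⟨hx, -⟩ ⟨i, -, hi, rfl⟩
      exact hRZ hx i (by omega) rfl
    · refine Connected.induce_congr (connected_reachIn (rest k d \ {y}) u) ?_
      rw [Set.insert_sdiff_singleton, Set.insert_eq_of_mem (self_mem_reachIn _ _)]
    · exact connected_induce_insert (h.connected (Nat.zero_le _) (by omega))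
        ⟨0, le_rfl, by omega, rfl⟩ h.adj_a
    · have := Set.ncard_sdiff_singleton_of_mem (s := R) (self_mem_reachIn _ u)
      omega
    · rw [h.ncard (by omega)]; omega
  have h1 := main y₁ hadj hy1Z
  have h2 := main y₂ hy2 hy2Z
  have h3 := Set.ncard_le_ncard (reachIn_subset_union (Z := rest k d) hadj hy2 hy21.symm)
    (Set.toFinite _)
  have h4 := Set.ncard_union_le (reachIn G (rest k d \ {y₁}) u) (reachIn G (rest k d \ {y₂}) u)
  omega

end ThreadEnds

/-! ### Cycles and paths with clumps at the ends -/

/-- `G` consists of a path with vertices `p 0, …, p (m - 1)` and of further vertices attached to its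
two ends. The map `φ` sends the vertices at an end to that end. -/
structure IsBlobPath (G : SimpleGraph V) (m β : ℕ) (p : ℕ → V) (φ : V → ℕ) : Prop where
  three_le : 3 ≤ m
  lt : ∀ x, φ x < m
  map_p : ∀ i < m, φ (p i) = i
  adj : ∀ i, i + 1 < m → G.Adj (p i) (p (i + 1))
  interior : ∀ x, 0 < φ x → φ x + 1 < m → x = p (φ x)
  edge : ∀ x y, G.Adj x y → φ x = φ y ∨ (φ x + 1 = φ y ∧ x = p (φ x) ∧ y = p (φ y)) ∨
    (φ y + 1 = φ x ∧ x = p (φ x) ∧ y = p (φ y))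
  card_le : ∀ i, {x | φ x = i}.ncard ≤ β

theorem reachIn_subset_of_mem {Z : Set V} {a x : V} (hx : x ∈ reachIn G Z a) :
    reachIn G Z x ⊆ reachIn G Z a := fun _ hy => Relation.ReflTransGen.trans hx hy

theorem mem_reachIn_symm {Z : Set V} {a x : V} (ha : a ∈ Z) (hx : x ∈ reachIn G Z a) :
    a ∈ reachIn G Z x := by
  refine subset_reachIn (connected_reachIn (G := G) Z a) hx ?_ (self_mem_reachIn _ _)
  intro y hy
  rcases reachIn_subset hy with rfl | h
  · exact ha
  · exact h

/-- The clumps are what `a` and `b` reach off the thread. They are disjoint because `b` is not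
reached from `a`, and by connectivity they and the thread cover the graph. The path is the thread
prolonged by `a` and `b`. -/
theorem ThreadEnds.exists_isBlobPath [Finite V] {k : ℕ} {d : ℕ → V} {a b : V} {β : ℕ}
    (h : ThreadEnds G k d a b) (hG : G.Connected) (ha : a ∈ rest k d) (hb : b ∈ rest k d)
    (hab : b ∉ reachIn G (rest k d) a)
    (hβ : 1 ≤ β) (hA : (reachIn G (rest k d) a).ncard ≤ β)
    (hB : (reachIn G (rest k d) b).ncard ≤ β) : ∃ p φ, IsBlobPath G (k + 2) β p φ := by
  classical
  have hk3 := h.three_le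
  set A := reachIn G (rest k d) a with hAdef
  set B := reachIn G (rest k d) b with hBdef
  have haA : a ∈ A := self_mem_reachIn _ _
  have hbB : b ∈ B := self_mem_reachIn _ _
  have hAZ : ∀ x ∈ A, x ∈ rest k d := by
    intro x hx
    rcases reachIn_subset hx with rfl | h'
    · exact ha
    · exact h'
  have hBZ : ∀ x ∈ B, x ∈ rest k d := by
    intro x hx
    rcases reachIn_subset hx with rfl | h'
    · exact hb
    · exact h'
  have hAB : ∀ x ∈ A, x ∉ B := by
    intro x hx hxB
    exact hab (reachIn_subset_of_mem hx (mem_reachIn_symm hb hxB))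
  have hcover : ∀ x, x ∈ A ∨ x ∈ B ∨ ∃ i < k, x = d i := by
    intro x
    by_contra hx
    obtain ⟨u, hu, v, -, hv, -, huv⟩ := exists_adj_of_connected_induce
      (T := {x | x ∈ A ∨ x ∈ B ∨ ∃ i < k, x = d i}) (connected_induce_univ hG) (a := a)
      (Or.inl haA) trivial (x := x) trivial hx
    have hvZ : v ∈ rest k d := fun i hi hvi => hv (Or.inr (Or.inr ⟨i, hi, hvi⟩))
    rcases hu with hu | hu | ⟨i, hi, rfl⟩
    · exact hv (Or.inl (mem_reachIn_of_adj hu huv hvZ))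
    · exact hv (Or.inr (Or.inl (mem_reachIn_of_adj hu huv hvZ)))
    · rcases h.adj_cases hi huv with ⟨h2, h3⟩ | ⟨h2, h3⟩ | ⟨h2, h3⟩ | ⟨h2, h3⟩
      · exact hvZ _ (by omega) h3
      · exact hvZ _ (by omega) h3
      · exact hv (Or.inl (h3 ▸ haA))
      · exact hv (Or.inr (Or.inl (h3 ▸ hbB)))
  have hex : ∀ x, ∃ n, (x ∈ A ∧ n = 0) ∨ (x ∈ B ∧ n = k + 1) ∨ (∃ i < k, x = d i ∧ n = i + 1) := by
    intro x
    rcases hcover x with hx | hx | ⟨i, hi, hx⟩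
    · exact ⟨0, Or.inl ⟨hx, rfl⟩⟩
    · exact ⟨k + 1, Or.inr (Or.inl ⟨hx, rfl⟩)⟩
    · exact ⟨i + 1, Or.inr (Or.inr ⟨i, hi, hx, rfl⟩)⟩
  choose φ hφ using hex
  have hφA : ∀ x ∈ A, φ x = 0 := by
    intro x hx
    rcases hφ x with ⟨-, h1⟩ | ⟨h1, -⟩ | ⟨i, hi, h1, -⟩
    · exact h1
    · exact absurd h1 (hAB x hx)
    · exact absurd h1 (hAZ x hx i hi)
  have hφB : ∀ x ∈ B, φ x = k + 1 := by
    intro x hx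
    rcases hφ x with ⟨h1, -⟩ | ⟨-, h1⟩ | ⟨i, hi, h1, -⟩
    · exact absurd hx (hAB x h1)
    · exact h1
    · exact absurd h1 (hBZ x hx i hi)
  have hφd : ∀ i < k, φ (d i) = i + 1 := by
    intro i hi
    rcases hφ (d i) with ⟨h1, -⟩ | ⟨h1, -⟩ | ⟨j, hj, h1, h2⟩
    · exact absurd rfl (hAZ _ h1 i hi)
    · exact absurd rfl (hBZ _ h1 i hi)
    · rw [h2, h.inj i hi j hj h1]
  let p : ℕ → V := fun i => if i = 0 then a else if i = k + 1 then b else d (i - 1)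
  have hp0 : p 0 = a := by simp [p]
  have hpk : p (k + 1) = b := by simp [p]
  have hpd : ∀ i < k, p (i + 1) = d i := by
    intro i hi
    have : i ≠ k := by omega
    simp [p, this]
  have hstep : ∀ i < k, ∀ y, G.Adj (d i) y →
      (φ (d i) + 1 = φ y ∧ d i = p (φ (d i)) ∧ y = p (φ y)) ∨
      (φ y + 1 = φ (d i) ∧ d i = p (φ (d i)) ∧ y = p (φ y)) := by
    intro i hi y hy
    rw [hφd i hi]
    rcases h.adj_cases hi hy with ⟨h2, rfl⟩ | ⟨h2, rfl⟩ | ⟨h2, rfl⟩ | ⟨h2, rfl⟩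
    · rw [hφd _ (by omega)]
      exact Or.inr ⟨by omega, (hpd i hi).symm, (hpd _ (by omega)).symm⟩
    · rw [hφd _ (by omega)]
      exact Or.inl ⟨by omega, (hpd i hi).symm, (hpd _ (by omega)).symm⟩
    · rw [hφA _ haA]
      exact Or.inr ⟨by omega, (hpd i hi).symm, hp0.symm⟩
    · rw [hφB _ hbB]
      exact Or.inl ⟨by omega, (hpd i hi).symm, hpk.symm⟩
  refine ⟨p, φ, by omega, ?_, ?_, ?_, ?_, ?_, ?_⟩
  · intro x
    rcases hφ x with ⟨-, h1⟩ | ⟨-, h1⟩ | ⟨i, hi, -, h1⟩ <;> omega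
  · intro i hi
    rcases Nat.eq_zero_or_pos i with rfl | hi0
    · rw [hp0, hφA a haA]
    by_cases hik : i = k + 1
    · rw [hik, hpk, hφB b hbB]
    · obtain ⟨j, rfl⟩ : ∃ j, i = j + 1 := ⟨i - 1, by omega⟩
      rw [hpd j (by omega), hφd j (by omega)]
  · intro i hi
    rcases Nat.eq_zero_or_pos i with rfl | hi0
    · rw [hp0, hpd 0 (by omega)]
      exact h.adj_a.symm
    obtain ⟨j, rfl⟩ : ∃ j, i = j + 1 := ⟨i - 1, by omega⟩
    rw [hpd j (by omega)]
    by_cases hjk : j + 1 = k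
    · rw [hjk, hpk, show j = k - 1 by omega]
      exact h.adj_b
    · rw [hpd (j + 1) (by omega)]
      exact h.adj j (by omega)
  · intro x h1 h2
    rcases hφ x with ⟨-, h3⟩ | ⟨-, h3⟩ | ⟨i, hi, h3, h4⟩
    · omega
    · omega
    · rw [h4, hpd i hi, h3]
  · intro x y hxy
    by_cases hx : ∃ i < k, x = d i
    · obtain ⟨i, hi, rfl⟩ := hx
      exact Or.inr (hstep i hi y hxy)
    by_cases hy : ∃ i < k, y = d i
    · obtain ⟨i, hi, rfl⟩ := hy
      rcases hstep i hi x hxy.symm with ⟨h1, h2, h3⟩ | ⟨h1, h2, h3⟩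
      · exact Or.inr (Or.inr ⟨h1, h3, h2⟩)
      · exact Or.inr (Or.inl ⟨h1, h3, h2⟩)
    left
    push Not at hx hy
    rcases hcover x with h1 | h1 | ⟨i, hi, h1⟩
    · rw [hφA x h1, hφA y (mem_reachIn_of_adj h1 hxy hy)]
    · rw [hφB x h1, hφB y (mem_reachIn_of_adj h1 hxy hy)]
    · exact absurd h1 (hx i hi)
  · intro i
    by_cases h0 : i = 0
    · refine le_trans (Set.ncard_le_ncard ?_ (Set.toFinite _)) hA
      intro x hx
      simp only [Set.mem_ofPred_eq] at hx
      rcases hφ x with ⟨h1, -⟩ | ⟨-, h1⟩ | ⟨j, hj, -, h1⟩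
      · exact h1
      · omega
      · omega
    by_cases hk : i = k + 1
    · refine le_trans (Set.ncard_le_ncard ?_ (Set.toFinite _)) hB
      intro x hx
      simp only [Set.mem_ofPred_eq] at hx
      rcases hφ x with ⟨-, h1⟩ | ⟨h1, -⟩ | ⟨j, hj, -, h1⟩
      · omega
      · exact h1
      · omega
    · refine le_trans ?_ hβ
      rw [← Set.ncard_singleton (d (i - 1))]
      refine Set.ncard_le_ncard ?_ (Set.toFinite _)
      intro x hx
      simp only [Set.mem_ofPred_eq] at hx
      rcases hφ x with ⟨-, h1⟩ | ⟨-, h1⟩ | ⟨j, hj, h2, h1⟩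
      · omega
      · omega
      · rw [h2, show i - 1 = j by omega]
        rfl

/-- A large connected graph without balance and with few leaves is a cycle or a path with few
vertices attached to its ends. -/
theorem isCycle_or_exists_isBlobPath [Fintype V] (hG : G.Connected) {c : ℕ}
    (hcard : 2 * c ^ 2 + 2 ≤ Fintype.card V + c)
    (hleaf : ∀ S L, LeafInv G S L → L.card + 2 ≤ c) (hbal : ¬ HasBalance G (c + 1)) :
    (∃ k, 3 ≤ k ∧ Nonempty (G ≃g SimpleGraph.cycleGraph k)) ∨
      ∃ m p φ, IsBlobPath G m (2 * c + 2) p φ := by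
  classical
  have hc : 2 ≤ c := by
    obtain ⟨a⟩ := hG.nonempty
    have := hleaf _ _ (LeafInv.singleton a)
    omega
  obtain ⟨q, hq, hqn, hqlen⟩ := exists_long_path hG hcard hleaf
  let P : ℕ → Prop := fun n => ∃ d, IsThread G n d
  have hPle : ∀ n, P n → n ≤ Fintype.card V := by
    rintro n ⟨d, hd⟩
    have : Function.Injective (fun i : Fin n => d i) :=
      fun i j hij => Fin.ext (hd.inj i i.2 j j.2 hij)
    simpa using Fintype.card_le_of_injective _ this
  have hP : P (2 * c + 2) := exists_isThread hq hqn hqlen hbal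
  obtain ⟨d, hd⟩ : P (Nat.findGreatest P (Fintype.card V)) :=
    Nat.findGreatest_spec (hPle _ hP) hP
  -- The longest thread has at least `2 * (c + 1)` vertices, enough to give `c + 1` of them to each
  -- branch at once.
  have hk : 2 * c + 2 ≤ Nat.findGreatest P (Fintype.card V) :=
    Nat.le_findGreatest (hPle _ hP) hP
  have hmax : ∀ d', ¬ IsThread G (Nat.findGreatest P (Fintype.card V) + 1) d' := by
    intro d' hd'
    have := Nat.le_findGreatest (P := P) (hPle _ ⟨d', hd'⟩) ⟨d', hd'⟩
    omega
  generalize Nat.findGreatest P (Fintype.card V) = k at hd hk hmax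
  obtain ⟨a, b, h⟩ := hd.exists_ends (by omega)
  by_cases ha : ∃ i < k, a = d i
  · exact Or.inl ⟨k, by omega, h.nonempty_iso hG ha⟩
  right
  push Not at ha
  have hb := h.b_notMem ha
  have hda := h.degree_ne hmax ha
  have hrb : b ∈ ThreadEnds.rest k (fun i => d (k - 1 - i)) := by
    rw [ThreadEnds.rest_reverse]
    exact hb
  have hdb := h.reverse.degree_ne hmax hrb
  have hab : b ∉ reachIn G (ThreadEnds.rest k d) a := fun hcon =>
    hbal (h.hasBalance_of_joined (by omega) (by omega) ha hda hcon)
  have hba : a ∉ reachIn G (ThreadEnds.rest k d) b := fun hcon =>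
    hab (mem_reachIn_symm hb hcon)
  have hA := h.ncard_reachIn_le (t := c + 1) (by omega) (by omega) ha hda hab hbal
  have hB := h.reverse.ncard_reachIn_le (t := c + 1) (by omega) (by omega) hrb hdb
    (by rw [ThreadEnds.rest_reverse]; exact hba) hbal
  rw [ThreadEnds.rest_reverse] at hB
  obtain ⟨p, φ, hp⟩ := h.exists_isBlobPath (β := 2 * c + 2) hG ha hb hab (by omega) (by omega)
    (by omega)
  exact ⟨_, p, φ, hp⟩

end Shape

universe u v

/-! ### Vortices from retractions -/

section Vortex

variable {X X' U : Type*}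

theorem AddsVortex.mono {X U : Type*} {K : SimpleGraph U} {k : ℕ} {F : Fin k → U} {w w' : ℕ}
    {Γ : SimpleGraph X} {f : U ↪ X} (h : AddsVortex K F w Γ f) (hw : w ≤ w') :
    AddsVortex K F w' Γ f := by
  obtain ⟨S, hS, hc⟩ := h
  exact ⟨S, hS, fun i => (hc i).trans (by exact_mod_cast hw)⟩

theorem AddsVortex.of_iso {K : SimpleGraph U} {k : ℕ} {F : Fin k → U} {w : ℕ}
    {Γ : SimpleGraph X} {Γ' : SimpleGraph X'} {f : U ↪ X} (h : AddsVortex K F w Γ f)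
    (φ : Γ ≃g Γ') : AddsVortex K F w Γ' (f.trans φ.toEquiv.toEmbedding) := by
  obtain ⟨S, hS, hc⟩ := h
  have hmem : ∀ i x, x ∈ φ '' S i ↔ φ.symm x ∈ S i := by
    intro i x
    constructor
    · rintro ⟨y, hy, rfl⟩
      simpa using hy
    · intro hx
      exact ⟨_, hx, by simp⟩
  have hadj : ∀ x y, Γ'.Adj x y → Γ.Adj (φ.symm x) (φ.symm y) :=
    fun x y hxy => φ.symm.map_adj_iff.mpr hxy
  refine ⟨fun i => φ '' S i, ⟨?_, ?_, ?_, ?_, ?_, ?_, ?_⟩, ?_⟩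
  · intro a b hab
    exact φ.map_adj_iff.mpr (hS.map_adj a b hab)
  · intro x hx
    obtain ⟨i, hi⟩ := hS.new_vertex (φ.symm x) (by
      rintro ⟨a, ha⟩
      exact hx ⟨a, by simp [ha]⟩)
    exact ⟨i, (hmem i x).mpr hi⟩
  · intro x y hxy hn
    simp only [hmem] at hn
    obtain ⟨a, b, hab, ha, hb⟩ := hS.old_edge _ _ (hadj x y hxy) hn
    exact ⟨a, b, hab, by simp [ha], by simp [hb]⟩
  · intro i
    exact ⟨_, hS.facial_mem i, rfl⟩
  · intro i a ha
    rw [hmem] at ha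
    exact hS.old_mem i a (by simpa using ha)
  · intro x hx
    simp only [hmem] at hx ⊢
    exact hS.interval _ hx
  · intro x y hxy hx hy
    simp only [hmem] at hx hy ⊢
    exact hS.edge_mem _ _ (hadj x y hxy) hx hy
  · intro i
    refine le_trans (le_of_eq ?_) (hc i)
    exact φ.injective.encard_image _

/-- A vortex whose bags are the unions of the fibres of a retraction over two consecutive vertices
of the facial cycle. -/
theorem addsVortex_of_retraction [Finite X] {K : SimpleGraph U} {Γ : SimpleGraph X} {k β : ℕ}
    (hk : 3 ≤ k) {F : Fin k → U} (hF : Function.Injective F) (f : U ↪ X) (ρ : X → U)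
    (hρ : ∀ a, ρ (f a) = a) (hnew : ∀ x, x ∉ Set.range f → ρ x ∈ Set.range F)
    (hadj : ∀ a b, K.Adj a b → Γ.Adj (f a) (f b))
    (hedge : ∀ x y, Γ.Adj x y → ρ x ∉ Set.range F →
      x ∈ Set.range f ∧ y ∈ Set.range f ∧ K.Adj (ρ x) (ρ y))
    (hbag : ∀ x y i j, Γ.Adj x y → ρ x = F i → ρ y = F j →
      i = j ∨ (SimpleGraph.cycleGraph k).Adj i j)
    (hcard : ∀ i, {x | ρ x = F i}.ncard ≤ β) : AddsVortex K F (2 * β) Γ f := by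
  let nxt : Fin k → Fin k := fun i => if h : (i : ℕ) + 1 < k then ⟨i + 1, h⟩ else ⟨0, by omega⟩
  have hnxt : ∀ i j : Fin k, nxt i = j ↔ (i : ℕ) + 1 = j ∨ ((i : ℕ) + 1 = k ∧ (j : ℕ) = 0) := by
    intro i j
    have := i.2
    have := j.2
    by_cases h : (i : ℕ) + 1 < k
    · simp only [nxt, h, dite_true, Fin.ext_iff]
      omega
    · simp only [nxt, h, dite_false, Fin.ext_iff]
      omega
  have hin : ∀ x, (∃ i, ρ x = F i ∨ ρ x = F (nxt i)) → ∃ j, ρ x = F j := by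
    rintro x ⟨i, h | h⟩
    · exact ⟨i, h⟩
    · exact ⟨_, h⟩
  have hfix : ∀ x, x ∈ Set.range f → f (ρ x) = x := by
    rintro _ ⟨a, rfl⟩
    rw [hρ]
  -- Bag `i` joins the fibres over `F i` and its successor, so that an edge between neighbouring
  -- fibres lies in one bag. This doubles the fibre bound.
  refine ⟨fun i => {x | ρ x = F i ∨ ρ x = F (nxt i)}, ⟨hadj, ?_, ?_, ?_, ?_, ?_, ?_⟩, ?_⟩
  · intro x hx
    obtain ⟨i, hi⟩ := hnew x hx
    exact ⟨i, Or.inl hi.symm⟩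
  · intro x y hxy hn
    by_cases hx : ρ x ∈ Set.range F
    · by_cases hy : ρ y ∈ Set.range F
      · obtain ⟨i, hi⟩ := hx
        obtain ⟨j, hj⟩ := hy
        exact absurd ⟨⟨i, Or.inl hi.symm⟩, ⟨j, Or.inl hj.symm⟩⟩ hn
      · obtain ⟨h1, h2, h3⟩ := hedge y x hxy.symm hy
        exact ⟨_, _, h3.symm, hfix x h2, hfix y h1⟩
    · obtain ⟨h1, h2, h3⟩ := hedge x y hxy hx
      exact ⟨_, _, h3, hfix x h1, hfix y h2⟩
  · intro i
    exact Or.inl (hρ _)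
  · rintro i a (h | h)
    · exact ⟨i, by rw [← h, hρ]⟩
    · exact ⟨nxt i, by rw [← h, hρ]⟩
  · intro x hx
    obtain ⟨j, hj⟩ := hin x hx
    have hset : ∀ l : Fin k, l ∈ {l | x ∈ {x | ρ x = F l ∨ ρ x = F (nxt l)}} ↔
        (l : ℕ) = j ∨ (l : ℕ) + 1 = j ∨ ((l : ℕ) + 1 = k ∧ (j : ℕ) = 0) := by
      intro l
      simp only [Set.mem_ofPred_eq, hj, hF.eq_iff]
      rw [eq_comm (a := j) (b := nxt l), hnxt, Fin.ext_iff]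
      omega
    -- A vertex over `F j` lies in the bags `j - 1` and `j`; for `j = 0` these are the last and the
    -- first one.
    by_cases hj0 : (j : ℕ) = 0
    · refine ⟨⟨k - 1, by omega⟩, j, Or.inr ?_⟩
      ext l
      have := l.2
      rw [hset]
      simp only [Set.mem_union, Set.mem_Ici, Set.mem_Iic, Fin.le_def]
      omega
    · refine ⟨⟨j - 1, by omega⟩, j, Or.inl ?_⟩
      ext l
      have := l.2
      rw [hset]
      simp only [Set.mem_Icc, Fin.le_def]
      omega
  · intro x y hxy hx hy
    obtain ⟨i, hi⟩ := hin x hx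
    obtain ⟨j, hj⟩ := hin y hy
    rcases hbag x y i j hxy hi hj with rfl | hij
    · exact ⟨i, Or.inl hi, Or.inl hj⟩
    · rw [cycleGraph_adj_iff (by omega)] at hij
      by_cases hn : nxt i = j
      · exact ⟨i, Or.inl hi, Or.inr (hn ▸ hj)⟩
      · have hn' : nxt j = i := by
          rw [hnxt] at hn ⊢
          omega
        exact ⟨j, Or.inr (hn' ▸ hi), Or.inl hj⟩
  · intro i
    rw [← (Set.toFinite _).cast_ncard_eq]
    have h1 := Set.ncard_union_le {x | ρ x = F i} {x | ρ x = F (nxt i)}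
    have h2 := hcard i
    have h3 := hcard (nxt i)
    show (({x | ρ x = F i} ∪ {x | ρ x = F (nxt i)} : Set X).ncard : ℕ∞) ≤ ((2 * β : ℕ) : ℕ∞)
    exact_mod_cast (by omega : ({x | ρ x = F i} ∪ {x | ρ x = F (nxt i)}).ncard ≤ 2 * β)

end Vortex

/-! ### Products of cycles and paths with clumps -/

section Grids

variable {V : Type u} {W : Type v} {G : SimpleGraph V} {H : SimpleGraph W}

theorem isToroidalGrid_boxProd {m n : ℕ} (hm : 3 ≤ m) (hn : 3 ≤ n)
    (φ : G ≃g SimpleGraph.cycleGraph m) (ψ : H ≃g SimpleGraph.cycleGraph n) :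
    IsToroidalGrid (G.boxProd H) := by
  refine ⟨m, n, hm, hn, ⟨⟨Equiv.prodCongr φ.toEquiv ψ.toEquiv, ?_⟩⟩⟩
  rintro ⟨a, b⟩ ⟨a', b'⟩
  simp only [toroidalGrid, SimpleGraph.boxProd_adj, Equiv.prodCongr_apply, Prod.map_apply]
  have h1 : (SimpleGraph.cycleGraph m).Adj (φ a) (φ a') ↔ G.Adj a a' := φ.map_adj_iff
  have h2 : (SimpleGraph.cycleGraph n).Adj (ψ b) (ψ b') ↔ H.Adj b b' := ψ.map_adj_iff
  have h3 : φ a = φ a' ↔ a = a' := φ.injective.eq_iff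
  have h4 : ψ b = ψ b' ↔ b = b' := ψ.injective.eq_iff
  exact or_congr (and_congr h1 h4) (and_congr h2 h3)

theorem IsCylindricalGridWithVortices.of_iso {X X' : Type u} {Γ : SimpleGraph X}
    {Γ' : SimpleGraph X'} {w : ℕ} (h : IsCylindricalGridWithVortices Γ w) (φ : Γ ≃g Γ') :
    IsCylindricalGridWithVortices Γ' w := by
  obtain ⟨m, n, hm, hn, k, l, F, F', hF, hF', U, K, f, g, h1, h2⟩ := h
  exact ⟨m, n, hm, hn, k, l, F, F', hF, hF', U, K, f, _, h1, h2.of_iso φ⟩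

theorem IsCylindricalGridWithVortices.mono {X : Type u} {Γ : SimpleGraph X} {w w' : ℕ}
    (h : IsCylindricalGridWithVortices Γ w) (hw : w ≤ w') : IsCylindricalGridWithVortices Γ w' := by
  obtain ⟨m, n, hm, hn, k, l, F, F', hF, hF', U, K, f, g, h1, h2⟩ := h
  exact ⟨m, n, hm, hn, k, l, F, F', hF, hF', U, K, f, g, h1.mono hw, h2.mono hw⟩

theorem IsPlanarGridWithVortex.mono {X : Type u} {Γ : SimpleGraph X} {w w' : ℕ}
    (h : IsPlanarGridWithVortex Γ w) (hw : w ≤ w') : IsPlanarGridWithVortex Γ w' := by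
  obtain ⟨m, n, hm, hn, k, F, hF, f, h1⟩ := h
  exact ⟨m, n, hm, hn, k, F, hF, f, h1.mono hw⟩

theorem isCycleThrough_cylindricalGrid {m n : ℕ} (hn : 3 ≤ n) (i : Fin m) :
    IsCycleThrough (cylindricalGrid m n) {p | p.1 = i} fun j => (i, j) := by
  refine ⟨hn, fun a b hab => (Prod.ext_iff.mp hab).2, ?_, fun a b hab => Or.inr ⟨hab, rfl⟩⟩
  ext ⟨a, b⟩
  simp [eq_comm]

theorem IsBlobPath.injective {m β : ℕ} {p : ℕ → V} {φ : V → ℕ} (h : IsBlobPath G m β p φ)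
    {i j : ℕ} (hi : i < m) (hj : j < m) (hij : p i = p j) : i = j := by
  rw [← h.map_p i hi, ← h.map_p j hj, hij]

theorem isCylindricalGridWithVortices_boxProd [Finite V] [Finite W] {m n β : ℕ} {p : ℕ → V}
    {φ : V → ℕ} (hG : IsBlobPath G m β p φ) (hn : 3 ≤ n) (θ : H ≃g SimpleGraph.cycleGraph n) :
    IsCylindricalGridWithVortices (G.boxProd H) (2 * β) := by
  have hm := hG.three_le
  -- The intermediate graph `K` keeps the clump at the end `0` and reduces the one at the end `m -
  -- 1` to its attachment vertex. The first vortex retracts `K` onto the grid, the second retracts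
  -- the product onto `K`.
  let U : Type (max u v) := {x : V × W // φ x.1 = m - 1 → x.1 = p (m - 1)}
  let K : SimpleGraph U := (G.boxProd H).comap Subtype.val
  let f : (Fin m × Fin n) ↪ U := ⟨fun x => ⟨(p x.1, θ.symm x.2), fun h => by
      simp only at h ⊢
      rw [hG.map_p _ x.1.2] at h
      rw [h]⟩, by
    rintro ⟨a, b⟩ ⟨a', b'⟩ hab
    have hab' := Prod.ext_iff.mp (Subtype.ext_iff.mp hab)
    simp only at hab'
    exact Prod.ext (Fin.ext (hG.injective a.2 a'.2 hab'.1)) (θ.symm.injective hab'.2)⟩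
  let g : U ↪ V × W := ⟨Subtype.val, Subtype.val_injective⟩
  have hstep : ∀ x y : V × W, (G.boxProd H).Adj x y → ∀ i j : Fin n, θ x.2 = i → θ y.2 = j →
      i = j ∨ (SimpleGraph.cycleGraph n).Adj i j := by
    rintro x y (⟨-, h⟩ | ⟨h, -⟩) i j rfl rfl
    · exact Or.inl (by rw [h])
    · exact Or.inr (θ.map_adj_iff.mpr h)
  refine ⟨m, n, by omega, hn, n, n, fun j => (⟨0, by omega⟩, j), fun j => (⟨m - 1, by omega⟩, j),
    ?_, ?_, U, K, f, g, ?_, ?_⟩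
  · convert isCycleThrough_cylindricalGrid hn (⟨0, by omega⟩ : Fin m) using 1
    ext x
    simp [bottomVertices, Fin.ext_iff]
  · convert isCycleThrough_cylindricalGrid hn (⟨m - 1, by omega⟩ : Fin m) using 1
    ext x
    simp only [topVertices, Fin.ext_iff, Set.mem_ofPred_eq]
    omega
  · have hp : ∀ x : U, φ x.1.1 ≠ 0 → x.1.1 = p (φ x.1.1) := by
      intro x hx
      have := hG.lt x.1.1
      by_cases h1 : φ x.1.1 = m - 1
      · rw [h1]; exact x.2 h1
      · exact hG.interior _ (by omega) (by omega)
    have hrange : ∀ x : U, x.1.1 = p (φ x.1.1) → x ∈ Set.range f := by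
      intro x hx
      refine ⟨(⟨φ x.1.1, hG.lt _⟩, θ x.1.2), Subtype.ext (Prod.ext hx.symm ?_)⟩
      exact θ.symm_apply_apply _
    refine addsVortex_of_retraction hn (fun a b hab => (Prod.ext_iff.mp hab).2) f
      (fun x => (⟨φ x.1.1, hG.lt _⟩, θ x.1.2)) ?_ ?_ ?_ ?_ ?_ ?_
    · rintro ⟨a, b⟩
      refine Prod.ext (Fin.ext (hG.map_p a a.2)) ?_
      exact θ.apply_symm_apply _
    · intro x hx
      have h0 : φ x.1.1 = 0 := by
        by_contra h0
        exact hx (hrange x (hp x h0))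
      exact ⟨θ x.1.2, Prod.ext (Fin.ext h0.symm) rfl⟩
    · rintro ⟨a, b⟩ ⟨a', b'⟩ (⟨h1, h2⟩ | ⟨h1, h2⟩)
      · simp only at h1 h2
        refine Or.inl ⟨?_, congrArg (fun j : Fin n => θ.symm j) h2⟩
        rw [SimpleGraph.pathGraph_adj] at h1
        rcases h1 with h1 | h1
        · show G.Adj (p a) (p a')
          rw [← h1]
          exact hG.adj a (by omega)
        · show G.Adj (p a) (p a')
          rw [← h1]
          exact (hG.adj a' (by omega)).symm
      · simp only at h1 h2
        exact Or.inr ⟨θ.symm.map_adj_iff.mpr h1, congrArg (fun i : Fin m => p i) h2⟩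
    · intro x y hxy hx
      have h0 : φ x.1.1 ≠ 0 := fun h0 => hx ⟨θ x.1.2, Prod.ext (Fin.ext h0.symm) rfl⟩
      refine ⟨hrange x (hp x h0), ?_⟩
      rcases hxy with ⟨h1, h2⟩ | ⟨h1, h2⟩
      · rcases hG.edge _ _ h1 with h3 | ⟨h3, -, h4⟩ | ⟨h3, -, h4⟩
        · have h5 : x.1.1 = y.1.1 := by rw [hp x h0, hp y (h3 ▸ h0), h3]
          exact absurd h5 h1.ne
        · refine ⟨hrange y h4, Or.inl ⟨?_, congrArg θ h2⟩⟩
          rw [SimpleGraph.pathGraph_adj]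
          exact Or.inl h3
        · refine ⟨hrange y h4, Or.inl ⟨?_, congrArg θ h2⟩⟩
          rw [SimpleGraph.pathGraph_adj]
          exact Or.inr h3
      · refine ⟨hrange y (hp y ?_ ), Or.inr ⟨θ.map_adj_iff.mpr h1, ?_⟩⟩
        · rwa [← h2]
        · exact Fin.ext (congrArg φ h2)
    · intro x y i j hxy hx hy
      exact hstep x.1 y.1 hxy i j (Prod.ext_iff.mp hx).2 (Prod.ext_iff.mp hy).2
    · intro i
      refine le_trans (Set.ncard_le_ncard_of_injOn (fun x : U => x.1.1) ?_ ?_ (Set.toFinite _))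
        (hG.card_le 0)
      · intro x hx
        exact Fin.ext_iff.mp (Prod.ext_iff.mp hx).1
      · intro x hx y hy hxy
        refine Subtype.ext (Prod.ext hxy (θ.injective ?_))
        exact (Prod.ext_iff.mp hx).2.trans (Prod.ext_iff.mp hy).2.symm
  · classical
    have hpm : ∀ w : W, φ ((p (m - 1), w) : V × W).1 = m - 1 →
        ((p (m - 1), w) : V × W).1 = p (m - 1) := fun _ _ => rfl
    let ρ : V × W → U := fun x => if h : φ x.1 = m - 1 then ⟨(p (m - 1), x.2), hpm _⟩ else
      ⟨x, fun h' => absurd h' h⟩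
    have hρ1 : ∀ x, φ x.1 = m - 1 → ρ x = ⟨(p (m - 1), x.2), hpm _⟩ := fun x hx => dif_pos hx
    have hρ2 : ∀ x, φ x.1 ≠ m - 1 → (ρ x).1 = x := fun x hx => by
      simp only [ρ, dif_neg hx]
    have hρ3 : ∀ a : U, ρ a.1 = a := by
      intro a
      by_cases h : φ a.1.1 = m - 1
      · rw [hρ1 _ h]
        exact Subtype.ext (Prod.ext (a.2 h).symm rfl)
      · exact Subtype.ext (hρ2 _ h)
    have hρsnd : ∀ x, (ρ x).1.2 = x.2 := by
      intro x
      by_cases h : φ x.1 = m - 1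
      · rw [hρ1 _ h]
      · rw [hρ2 _ h]
    have hθ : ∀ x i, ρ x = f (⟨m - 1, by omega⟩, i) → θ x.2 = i := by
      intro x i h
      have h2 : x.2 = θ.symm i := by rw [← hρsnd x, h]; rfl
      rw [h2]
      exact θ.apply_symm_apply _
    refine addsVortex_of_retraction hn (F := fun i => f (⟨m - 1, by omega⟩, i)) ?_ g ρ hρ3 ?_
      (fun a b hab => hab) ?_ ?_ ?_
    · intro a b hab
      exact (Prod.ext_iff.mp (f.injective hab)).2
    · intro x hx
      have h : φ x.1 = m - 1 := by
        by_contra h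
        exact hx ⟨ρ x, hρ2 x h⟩
      refine ⟨θ x.2, ?_⟩
      rw [hρ1 _ h]
      exact Subtype.ext (Prod.ext rfl (θ.symm_apply_apply _))
    · intro x y hxy hx
      have h : φ x.1 ≠ m - 1 := by
        intro h
        refine hx ⟨θ x.2, ?_⟩
        rw [hρ1 _ h]
        exact Subtype.ext (Prod.ext rfl (θ.symm_apply_apply _))
      have hy : φ y.1 = m - 1 → y.1 = p (m - 1) := by
        intro hy
        -- An edge entering a clump from outside enters it at its attachment vertex, which is kept
        -- in `K`.
        rcases hxy with ⟨h1, -⟩ | ⟨-, h1⟩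
        · rcases hG.edge _ _ h1 with h3 | ⟨-, -, h4⟩ | ⟨-, -, h4⟩
          · exact absurd (h3.trans hy) h
          · rw [hy] at h4; exact h4
          · rw [hy] at h4; exact h4
        · rw [← h1] at hy
          exact absurd hy h
      have hyg : g ⟨y, hy⟩ = y := rfl
      have hρy : (ρ y).1 = y := by rw [← hyg]; exact congrArg Subtype.val (hρ3 ⟨y, hy⟩)
      refine ⟨⟨ρ x, hρ2 x h⟩, ⟨⟨y, hy⟩, rfl⟩, ?_⟩
      show (G.boxProd H).Adj (ρ x).1 (ρ y).1
      rwa [hρ2 x h, hρy]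
    · intro x y i j hxy hx hy
      exact hstep x y hxy i j (hθ x i hx) (hθ y j hy)
    · intro i
      refine le_trans (Set.ncard_le_ncard_of_injOn (fun x : V × W => x.1) ?_ ?_ (Set.toFinite _))
        (hG.card_le (m - 1))
      · intro x hx
        by_contra h
        apply h
        have h2 : x = (f (⟨m - 1, by omega⟩, i)).1 := by rw [← hρ2 x h, hx]
        have h3 : x.1 = p (m - 1) := by rw [h2]; rfl
        show φ x.1 = m - 1
        rw [h3]
        exact hG.map_p _ (by omega)
      · intro x hx y hy hxy
        exact Prod.ext hxy (θ.injective ((hθ x i hx).trans (hθ y i hy).symm))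

/-- The first coordinate of the `i`-th vertex on the boundary of the grid with sides of length `a`
and `b`. -/
def boundaryX (a b i : ℕ) : ℕ :=
  if i < a then i else if i < a + b then a else if i < 2 * a + b then 2 * a + b - i else 0

/-- The second coordinate of the `i`-th vertex on the boundary of the grid with sides of length `a`
and `b`. -/
def boundaryY (a b i : ℕ) : ℕ :=
  if i < a then 0 else if i < a + b then i - a else if i < 2 * a + b then b else 2 * a + 2 * b - i

theorem boundary_cases {a b i : ℕ} (hi : i < 2 * a + 2 * b) :
    (i < a ∧ boundaryX a b i = i ∧ boundaryY a b i = 0) ∨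
    (a ≤ i ∧ i < a + b ∧ boundaryX a b i = a ∧ boundaryY a b i + a = i) ∨
    (a + b ≤ i ∧ i < 2 * a + b ∧ boundaryX a b i + i = 2 * a + b ∧ boundaryY a b i = b) ∨
    (2 * a + b ≤ i ∧ boundaryX a b i = 0 ∧ boundaryY a b i + i = 2 * a + 2 * b) := by
  simp only [boundaryX, boundaryY]
  split_ifs <;> omega

theorem boundary_surjective {a b x y : ℕ} (ha : 0 < a) (hb : 0 < b) (hx : x ≤ a) (hy : y ≤ b)
    (h : x = 0 ∨ x = a ∨ y = 0 ∨ y = b) :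
    ∃ i < 2 * a + 2 * b, boundaryX a b i = x ∧ boundaryY a b i = y := by
  obtain ⟨i, hi⟩ : ∃ i, (y = 0 ∧ x < a ∧ i = x) ∨ (x = a ∧ y < b ∧ i = a + y) ∨
      (y = b ∧ 0 < x ∧ i + x = 2 * a + b) ∨ (x = 0 ∧ 0 < y ∧ i + y = 2 * a + 2 * b) := by
    by_cases h1 : y = 0 ∧ x < a
    · exact ⟨x, Or.inl ⟨h1.1, h1.2, rfl⟩⟩
    by_cases h2 : x = a ∧ y < b
    · exact ⟨a + y, Or.inr (Or.inl ⟨h2.1, h2.2, rfl⟩)⟩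
    by_cases h3 : y = b ∧ 0 < x
    · exact ⟨2 * a + b - x, Or.inr (Or.inr (Or.inl ⟨h3.1, h3.2, by omega⟩))⟩
    · exact ⟨2 * a + 2 * b - y, Or.inr (Or.inr (Or.inr ⟨by omega, by omega, by omega⟩))⟩
  have hik : i < 2 * a + 2 * b := by omega
  refine ⟨i, hik, ?_⟩
  have := boundary_cases hik
  omega

theorem isPlanarGridWithVortex_boxProd [Finite V] [Finite W] {m n β : ℕ} {p : ℕ → V} {φ : V → ℕ}
    {q : ℕ → W} {ψ : W → ℕ} (hG : IsBlobPath G m β p φ) (hH : IsBlobPath H n β q ψ) :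
    IsPlanarGridWithVortex (G.boxProd H) (2 * β ^ 2) := by
  obtain ⟨a, rfl⟩ : ∃ a, m = a + 1 := ⟨m - 1, by have := hG.three_le; omega⟩
  obtain ⟨b, rfl⟩ : ∃ b, n = b + 1 := ⟨n - 1, by have := hH.three_le; omega⟩
  have ha : 2 ≤ a := by have := hG.three_le; omega
  have hb : 2 ≤ b := by have := hH.three_le; omega
  have hX : ∀ i : Fin (2 * a + 2 * b), boundaryX a b i < a + 1 := fun i => by
    have := boundary_cases i.2
    omega
  have hY : ∀ i : Fin (2 * a + 2 * b), boundaryY a b i < b + 1 := fun i => by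
    have := boundary_cases i.2
    omega
  let F : Fin (2 * a + 2 * b) → Fin (a + 1) × Fin (b + 1) := fun i =>
    (⟨boundaryX a b i, hX i⟩, ⟨boundaryY a b i, hY i⟩)
  have hFinj : Function.Injective F := by
    intro i j hij
    have h1 := Fin.ext_iff.mp (Prod.ext_iff.mp hij).1
    have h2 := Fin.ext_iff.mp (Prod.ext_iff.mp hij).2
    simp only [F] at h1 h2
    have := boundary_cases i.2
    have := boundary_cases j.2
    exact Fin.ext (by omega)
  have hFmem : ∀ z : Fin (a + 1) × Fin (b + 1), z ∈ Set.range F ↔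
      ((z.1 : ℕ) = 0 ∨ (z.1 : ℕ) = a ∨ (z.2 : ℕ) = 0 ∨ (z.2 : ℕ) = b) := by
    rintro ⟨⟨x, hx⟩, ⟨y, hy⟩⟩
    constructor
    · rintro ⟨i, hi⟩
      have h1 := Fin.ext_iff.mp (Prod.ext_iff.mp hi).1
      have h2 := Fin.ext_iff.mp (Prod.ext_iff.mp hi).2
      simp only [F] at h1 h2 ⊢
      have := boundary_cases i.2
      omega
    · intro h
      obtain ⟨i, hi, h1, h2⟩ := boundary_surjective (a := a) (b := b) (x := x) (y := y) (by omega)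
        (by omega) (by omega) (by omega) h
      exact ⟨⟨i, hi⟩, Prod.ext (Fin.ext h1) (Fin.ext h2)⟩
  -- The converse uses that `a` and `b` are at least `2`: the boundary of a grid with only two rows
  -- can have chords. It ensures that adjacent fibres over the boundary are consecutive.
  have hFadj : ∀ i j, (SimpleGraph.cycleGraph (2 * a + 2 * b)).Adj i j ↔
      (planarGrid (a + 1) (b + 1)).Adj (F i) (F j) := by
    intro i j
    rw [cycleGraph_adj_iff (by omega)]
    simp only [planarGrid, SimpleGraph.boxProd_adj, SimpleGraph.pathGraph_adj, F, Fin.mk.injEq]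
    have hi := boundary_cases i.2
    have hj := boundary_cases j.2
    have := i.2
    have := j.2
    constructor
    · intro h
      omega
    · intro h
      omega
  let f : (Fin (a + 1) × Fin (b + 1)) ↪ V × W := ⟨fun x => (p x.1, q x.2), by
    rintro ⟨x, y⟩ ⟨x', y'⟩ hxy
    have hxy' := Prod.ext_iff.mp hxy
    exact Prod.ext (Fin.ext (hG.injective x.2 x'.2 hxy'.1))
      (Fin.ext (hH.injective y.2 y'.2 hxy'.2))⟩
  have hrange : ∀ x : V × W, x.1 = p (φ x.1) → x.2 = q (ψ x.2) → x ∈ Set.range f := by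
    intro x h1 h2
    exact ⟨(⟨φ x.1, hG.lt _⟩, ⟨ψ x.2, hH.lt _⟩), Prod.ext h1.symm h2.symm⟩
  let ρ : V × W → Fin (a + 1) × Fin (b + 1) := fun x =>
    (⟨φ x.1, hG.lt _⟩, ⟨ψ x.2, hH.lt _⟩)
  have hinner : ∀ x, ρ x ∉ Set.range F → x.1 = p (φ x.1) ∧ x.2 = q (ψ x.2) := by
    intro x hx
    rw [hFmem] at hx
    simp only [ρ] at hx
    have h1 := hG.lt x.1
    have h2 := hH.lt x.2
    exact ⟨hG.interior _ (by omega) (by omega), hH.interior _ (by omega) (by omega)⟩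
  have hstep : ∀ x y, (G.boxProd H).Adj x y →
      ρ x = ρ y ∨ (planarGrid (a + 1) (b + 1)).Adj (ρ x) (ρ y) := by
    rintro x y (⟨h1, h2⟩ | ⟨h1, h2⟩)
    · rcases hG.edge _ _ h1 with h3 | ⟨h3, -⟩ | ⟨h3, -⟩
      · exact Or.inl (Prod.ext (Fin.ext h3) (Fin.ext (congrArg ψ h2)))
      · exact Or.inr (Or.inl ⟨SimpleGraph.pathGraph_adj.mpr (Or.inl h3),
          Fin.ext (congrArg ψ h2)⟩)
      · exact Or.inr (Or.inl ⟨SimpleGraph.pathGraph_adj.mpr (Or.inr h3),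
          Fin.ext (congrArg ψ h2)⟩)
    · rcases hH.edge _ _ h1 with h3 | ⟨h3, -⟩ | ⟨h3, -⟩
      · exact Or.inl (Prod.ext (Fin.ext (congrArg φ h2)) (Fin.ext h3))
      · exact Or.inr (Or.inr ⟨SimpleGraph.pathGraph_adj.mpr (Or.inl h3),
          Fin.ext (congrArg φ h2)⟩)
      · exact Or.inr (Or.inr ⟨SimpleGraph.pathGraph_adj.mpr (Or.inr h3),
          Fin.ext (congrArg φ h2)⟩)
  refine ⟨a + 1, b + 1, by omega, by omega, 2 * a + 2 * b, F, ⟨by omega, hFinj, ?_,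
    fun i j => (hFadj i j).mp⟩, f, ?_⟩
  · ext z
    rw [hFmem]
    simp only [outerVertices, Set.mem_ofPred_eq]
    omega
  · refine addsVortex_of_retraction (by omega) hFinj f ρ ?_ ?_ ?_ ?_ ?_ ?_
    · rintro ⟨x, y⟩
      exact Prod.ext (Fin.ext (hG.map_p x x.2)) (Fin.ext (hH.map_p y y.2))
    · intro x hx
      by_contra hcon
      have := hinner x hcon
      exact hx (hrange x this.1 this.2)
    · rintro ⟨x, y⟩ ⟨x', y'⟩ (⟨h1, h2⟩ | ⟨h1, h2⟩)
      · simp only [SimpleGraph.pathGraph_adj] at h1 h2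
        refine Or.inl ⟨?_, congrArg (fun i : Fin (b + 1) => q i) h2⟩
        show G.Adj (p x) (p x')
        rcases h1 with h1 | h1
        · rw [← h1]; exact hG.adj x (by omega)
        · rw [← h1]; exact (hG.adj x' (by omega)).symm
      · simp only [SimpleGraph.pathGraph_adj] at h1 h2
        refine Or.inr ⟨?_, congrArg (fun i : Fin (a + 1) => p i) h2⟩
        show H.Adj (q y) (q y')
        rcases h1 with h1 | h1
        · rw [← h1]; exact hH.adj y (by omega)
        · rw [← h1]; exact (hH.adj y' (by omega)).symm
    · intro x y hxy hx
      obtain ⟨hx1, hx2⟩ := hinner x hx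
      have hy : y.1 = p (φ y.1) ∧ y.2 = q (ψ y.2) := by
        by_cases hxy' : ρ x = ρ y
        · exact hinner y (hxy' ▸ hx)
        rcases hxy with ⟨h1, h2⟩ | ⟨h1, h2⟩
        · refine ⟨?_, h2 ▸ hx2⟩
          rcases hG.edge _ _ h1 with h3 | ⟨-, -, h4⟩ | ⟨-, -, h4⟩
          · exact absurd (Prod.ext (Fin.ext h3) (Fin.ext (congrArg ψ h2))) hxy'
          · exact h4
          · exact h4
        · refine ⟨h2 ▸ hx1, ?_⟩
          rcases hH.edge _ _ h1 with h3 | ⟨-, -, h4⟩ | ⟨-, -, h4⟩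
          · exact absurd (Prod.ext (Fin.ext (congrArg φ h2)) (Fin.ext h3)) hxy'
          · exact h4
          · exact h4
      refine ⟨hrange x hx1 hx2, hrange y hy.1 hy.2, ?_⟩
      rcases hstep x y hxy with h | h
      · exfalso
        apply hxy.ne
        have h1 := Fin.ext_iff.mp (Prod.ext_iff.mp h).1
        have h2 := Fin.ext_iff.mp (Prod.ext_iff.mp h).2
        simp only [ρ] at h1 h2
        exact Prod.ext (by rw [hx1, hy.1, h1]) (by rw [hx2, hy.2, h2])
      · exact h
    · intro x y i j hxy hx hy
      rcases hstep x y hxy with h | h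
      · exact Or.inl (hFinj (by rw [← hx, ← hy, h]))
      · rw [hx, hy] at h
        exact Or.inr ((hFadj i j).mpr h)
    · intro i
      -- A fibre over a boundary vertex is contained in a product of fibres of the two factors, so
      -- at a corner the bound `β` is squared.
      have hsub : {x | ρ x = F i} ⊆ {v | φ v = boundaryX a b i} ×ˢ {w | ψ w = boundaryY a b i} := by
        intro x hx
        exact ⟨Fin.ext_iff.mp (Prod.ext_iff.mp hx).1, Fin.ext_iff.mp (Prod.ext_iff.mp hx).2⟩
      refine (Set.ncard_le_ncard hsub (Set.toFinite _)).trans ?_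
      rw [Set.ncard_prod, sq]
      exact Nat.mul_le_mul (hG.card_le _) (hH.card_le _)

end Grids

/-! ### The structure theorem -/

/-- The number of leaves of a factor of a product with bounded Hadwiger number. -/
theorem LeafInv.card_add_two_le {V : Type u} {W : Type v} [Fintype V] [Fintype W] {c : ℕ}
    {G : SimpleGraph V} {H : SimpleGraph W} (hc : 1 ≤ c) (hG : G.Connected)
    (hcard : 2 * c ^ 2 + 2 ≤ Fintype.card V + c)
    (hη : ¬ IsMinor (⊤ : SimpleGraph (Fin (c + 1))) (G.boxProd H)) {S L : Finset W}
    (h : LeafInv H S L) : L.card + 2 ≤ c := by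
  by_contra hlt
  obtain ⟨q, rfl⟩ : ∃ q, c = q + 1 := ⟨c - 1, by omega⟩
  -- With `q = c - 1` leaves the clique minor has `q + 2 = c + 1` vertices.
  refine hη (h.isMinor (p := q) hG (by omega) ?_)
  have h1 : q.choose 2 ≤ q ^ 2 := Nat.choose_le_pow q 2
  nlinarith

end ProductMinor

open ProductMinor in
theorem mainTheorem2 {V W : Type*} [Fintype V] [Fintype W]
    (c : ℕ) (hc : 1 ≤ c)
    (G : SimpleGraph V) (H : SimpleGraph W)
    (hGconn : G.Connected) (hHconn : H.Connected)
    (hG : 2 * (c : ℤ) ^ 2 - c + 2 ≤ Fintype.card V)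
    (hH : 2 * (c : ℤ) ^ 2 - c + 2 ≤ Fintype.card W)
    (hη : ProductMinor.hadwigerNumber (G.boxProd H) ≤ c) :
    ProductMinor.IsPlanarGridWithVortex (G.boxProd H) (2 * (8 * c + 9) ^ 2) ∨
    ProductMinor.IsCylindricalGridWithVortices (G.boxProd H) (16 * c + 18) ∨
    ProductMinor.IsToroidalGrid (G.boxProd H) := by
  have hG' : 2 * c ^ 2 + 2 ≤ Fintype.card V + c := by zify; linarith
  have hH' : 2 * c ^ 2 + 2 ≤ Fintype.card W + c := by zify; linarith
  have hη₁ : ¬ IsMinor (⊤ : SimpleGraph (Fin (c + 1))) (G.boxProd H) := fun h => by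
    have := le_hadwigerNumber h
    omega
  -- The constructions treat the factors asymmetrically, so each is applied to both orders of the
  -- product.
  have hη₂ : ¬ IsMinor (⊤ : SimpleGraph (Fin (c + 1))) (H.boxProd G) := fun h =>
    hη₁ (h.of_iso (SimpleGraph.boxProdComm H G))
  have hleafH : ∀ S L, LeafInv H S L → L.card + 2 ≤ c := fun S L h =>
    h.card_add_two_le hc hGconn hG' hη₁
  have hleafG : ∀ S L, LeafInv G S L → L.card + 2 ≤ c := fun S L h =>
    h.card_add_two_le hc hHconn hH' hη₂
  have hbalG : ¬ HasBalance G (c + 1) := fun h => hη₁ (h.isMinor hHconn hH' hleafH)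
  have hbalH : ¬ HasBalance H (c + 1) := fun h => hη₂ (h.isMinor hGconn hG' hleafG)
  have hw : 2 * (2 * c + 2) ≤ 16 * c + 18 := by omega
  rcases isCycle_or_exists_isBlobPath hGconn hG' hleafG hbalG with ⟨k, hk, ⟨φ⟩⟩ | ⟨m, p, φ, hp⟩ <;>
    rcases isCycle_or_exists_isBlobPath hHconn hH' hleafH hbalH with ⟨l, hl, ⟨ψ⟩⟩ | ⟨n, q, ψ, hq⟩
  · exact Or.inr (Or.inr (isToroidalGrid_boxProd hk hl φ ψ))
  · exact Or.inr (Or.inl (((isCylindricalGridWithVortices_boxProd hq hk φ).of_iso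
      (SimpleGraph.boxProdComm H G)).mono hw))
  · exact Or.inr (Or.inl ((isCylindricalGridWithVortices_boxProd hp hl ψ).mono hw))
  · refine Or.inl ((isPlanarGridWithVortex_boxProd hp hq).mono ?_)
    gcongr <;> omega
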